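/- For $n\ge 0$ let $\mathcal C_n\subset[0,1]$ be the $n$-th generation of the middle-half Cantor set ($\mathcal C_0=[0,1]$, $\mathcal C_{n+1}=\tfrac14\mathcal C_n\cup(\tfrac34+\tfrac14\mathcal C_n)$) and let $\mathcal K_n=\mathcal C_n\times\mathcal C_n\subset\mathbb C$, a union of $4^n$ squares of side $4^{-n}$. For $g:\mathbb R\to\mathbb R$ (a noodle) put $\sigma_0^g(x,y)=(x-g(y),y)$ and $\sigma_\theta^g=R_{-\theta}\circ\sigma_0^g\circ R_\theta$, where $R_\theta$ is clockwise rotation by $\theta$; put $g_\tau(y)=g(y-\tau)$; and let $\mathrm{Proj}_\theta(E)=\{\mathrm{Re}(e^{-i\theta}z):z\in E\}\subset\mathbb R$. Fix $L>10$, let $P$ be normalized Lebesgue measure on $(-2,2)\times(-L,L)\times(0,2\pi)$, and define the Buffon noodle probability $$Bu^g(E)=P\big\{(x,\tau,\theta): x\in \mathrm{Proj}_\theta(\sigma_\theta^{g_\tau}(E))\big\}.$$ Then there is a constant $C>0$, depending only on $L$, such that a sequence of functions $g_n:\mathbb R\to\mathbb R$ is undercooked, i.e. $$Bu^{g_n}(\mathcal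 K_n)\ \ge\ C\,\frac{\log n}{n}\qquad\text{for all } n\ge 1,$$ in each of the following cases: 1. for all $n\ge1$, $g_n$ is twice differentiable and $|g_n(y)|<1$, $|g_n'(y)|<4^{-n/5}$, $|g_n''(y)|<4^{-n/5}$ for all $y\in\mathbb R$; 2. for all $n\ge1$, $g_n$ is differentiable and $|g_n(y)|<1$, $|g_n'(y)|<4^{-n}$ for all $y\in\mathbb R$; 3. for all $n\ge1$, $g_n$ is twice differentiable, $|g_n(y)|<1$ and $|g_n'(y)|<1/100$ for all $y\in\mathbb R$, and $\|g_n'\|_\infty^4\,\|g_n''\|_\infty<4^{-n}$ (suprema over $\mathbb R$); 4. $g_n(y)=4^{-n/2}\sin(4^{n/4}y)$. -/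

import Mathlib

open MeasureTheory
open scoped ENNReal

/-- The `n`-th generation of the middle-half Cantor set on `[0, 1]`:
`2 ^ n` intervals of length `4 ^ (-n)`. -/
def middleHalfCantor : ℕ → Set ℝ
  | 0 => Set.Icc 0 1
  | n + 1 =>
      (fun x => x / 4) '' middleHalfCantor n ∪ (fun x => (3 + x) / 4) '' middleHalfCantor n

/-- The `n`-th generation of the four-corner Cantor set, the Cartesian square of
`middleHalfCantor n`: `4 ^ n` squares of side length `4 ^ (-n)`. -/
def fourCorner (n : ℕ) : Set ℂ := middleHalfCantor n ×ℂ middleHalfCantor n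

/-- Clockwise rotation of the plane by the angle `θ`. -/
noncomputable def cwRot (θ : ℝ) (z : ℂ) : ℂ := Complex.exp (-(θ : ℂ) * Complex.I) * z

/-- The horizontal shear `(x, y) ↦ (x - g y, y)` along the noodle `g`. -/
noncomputable def shearZero (g : ℝ → ℝ) (z : ℂ) : ℂ := ⟨z.re - g z.im, z.im⟩

/-- The shear along `g` in the direction `θ`. -/
noncomputable def shear (g : ℝ → ℝ) (θ : ℝ) : ℂ → ℂ :=
  cwRot (-θ) ∘ shearZero g ∘ cwRot θ

/-- Orthogonal projection of `E` to the line spanned by `e ^ (i θ)`; the point `x * e ^ (i θ)` of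
this line is identified with the real number `x`. -/
noncomputable def projSet (θ : ℝ) (E : Set ℂ) : Set ℝ := (fun z => (cwRot θ z).re) '' E

/-- The translated noodle `y ↦ g (y - τ)`. -/
def translateNoodle (g : ℝ → ℝ) (τ : ℝ) : ℝ → ℝ := fun y => g (y - τ)

/-- Normalized Lebesgue measure on `(-2, 2) × (-L, L) × (0, 2π)`, the law of `(x, τ, θ)`. -/
noncomputable def noodleLaw (L : ℝ) : Measure (ℝ × ℝ × ℝ) :=
  ProbabilityTheory.cond volume
    (Set.Ioo (-2) 2 ×ˢ Set.Ioo (-L) L ×ˢ Set.Ioo 0 (2 * Real.pi))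

/-- The Buffon noodle probability of `E` for the noodle `g`: the probability that `x` lies in the
projection to direction `θ` of the image of `E` under the shear in direction `θ` along the
noodle translated by `τ`. -/
noncomputable def buffonNoodle (L : ℝ) (g : ℝ → ℝ) (E : Set ℂ) : ℝ :=
  (noodleLaw L).real
    {p : ℝ × ℝ × ℝ | p.1 ∈ projSet p.2.2 (shear (translateNoodle g p.2.1) p.2.2 '' E)}

/-- The sequence of noodles `g n` is undercooked with constant `C`. -/
def UndercookedWith (L C : ℝ) (g : ℕ → ℝ → ℝ) : Prop :=
  ∀ n : ℕ, 1 ≤ n → C * (Real.log n / n) ≤ buffonNoodle L (g n) (fourCorner n)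

/-- The supremum norm over the real line, possibly infinite. -/
noncomputable def supNorm (f : ℝ → ℝ) : ℝ≥0∞ := ⨆ y : ℝ, ENNReal.ofReal |f y|

/-!
The line `x` meets the sheared set in the direction `θ` exactly if some point `z` of the original
set has shadow `u - g (v - τ) = x`, where `u + i v` is `z` rotated by `θ`. The probability of this
is bounded from below by the second moment method, localized in `θ` as in the argument of Bateman
and Volberg for straight needles.

In the direction `(-2, 1)` (`goodAngle`) the projection of the four-corner set is an interval: if
the `4 ^ n` squares are numbered by `N < 4 ^ n` through base-`4` digits, their centres project to an
arithmetic progression with difference comparable to `4⁻ⁿ` (`squareCenter_projection`). Let the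
angle to this direction lie in the window between `4⁻ᵏ⁻¹` and `4⁻ᵏ`, and let the slope of the
noodle be at most `4⁻ᵏ`. Suppose two squares, whose smallest common ancestor has side comparable to
`4ʲ⁻ⁿ`, have overlapping shadows. Then their numbers differ by `O(4ʲ⁻ᵏ)`
(`le_add_of_common_shadow`). Since the two numbers lie on different sides of a multiple of `4ʲ`,
both are within `O(4ʲ⁻ᵏ)` of it, so that such pairs are rarer by a factor `16⁻ᵏ`, not only `4⁻ᵏ`,
than all pairs at this level (`card_close_pairs_le`).

For a single such pair with `j ≥ k` the angles with overlapping shadows form a set of diameter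
`O(4⁻ʲ)` (`volume_common_shadow_le`). Here the shear `τ ↦ v - τ`, with `v` taken at the second
square, which preserves the measure, fixes the position of the noodle relative to one square. The
difference of the two shadows is then, up to a small Lipschitz error, a strictly monotone function
of the angle, and no bound on the second derivative of the noodle is needed. Altogether the second
moment over the window is `O(n 16⁻ᵏ)` as long as `4ᵏ ≤ n` (`second_moment_le`), while the first
moment is comparable to `4⁻ᵏ`. By Cauchy–Schwarz each window contributes at least a multiple of
`1 / n` (`measureReal_iUnion_strip_ge`), and there are about `log n` windows with `4ᵏ ≤ n`.

The argument uses only that the slope is at most `1 / n` for large `n`; for the remaining `n` one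
square suffices. In all the cases considered the sixth power of the slope is at most `8 * 4⁻ⁿ`:
when only the product of the norms of `g'` and `g''` is controlled, this follows from Landau's
inequality `|g'|² ≤ 8 ‖g''‖` for noodles with `|g| < 1` (`sq_deriv_le_of_abs_deriv_deriv_le`).
-/

/-! ### The squares of the four-corner set -/

/-- The centre of the interval of `middleHalfCantor n` whose itinerary is read off from the base-`4`
digits of `N`, the most significant of the `n` digits first: the digit `d` selects the left child
if `e d = 0` and the right child if `e d = 1`. -/
noncomputable def cantorCenter (e : ℕ → ℕ) : ℕ → ℕ → ℝ
  | 0, _ => 1 / 2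
  | n + 1, N => (3 * (e (N / 4 ^ n) : ℝ) + cantorCenter e n (N % 4 ^ n)) / 4

/-- The centre of the square of `fourCorner n` with number `N < 4 ^ n`. The digit `d` of `N` selects
the corner `(1 - d / 2, d % 2)`, so that `-2 * x + y` increases by one with `d`. -/
noncomputable def squareCenter (n N : ℕ) : ℂ :=
  ⟨cantorCenter (fun d => 1 - d / 2) n N, cantorCenter (fun d => d % 2) n N⟩

lemma cantorCenter_mem_Icc {e : ℕ → ℕ} (he : ∀ d, e d ≤ 1) (n N : ℕ) :
    cantorCenter e n N ∈ Set.Icc (0 : ℝ) 1 := by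
  induction n generalizing N with
  | zero => simp only [cantorCenter]; norm_num
  | succ n ih =>
    obtain ⟨h0, h1⟩ := ih (N % 4 ^ n)
    have h2 : (e (N / 4 ^ n) : ℝ) ≤ 1 := by exact_mod_cast he _
    have h3 : (0 : ℝ) ≤ e (N / 4 ^ n) := by positivity
    simp only [cantorCenter, Set.mem_Icc]
    constructor <;> linarith

lemma mem_middleHalfCantor_of_near_center {e : ℕ → ℕ} (he : ∀ d, e d ≤ 1) (n N : ℕ) (x : ℝ)
    (hx : |x - cantorCenter e n N| ≤ (1 / 4) ^ n / 2) : x ∈ middleHalfCantor n := by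
  induction n generalizing N x with
  | zero =>
    simp only [cantorCenter, abs_le] at hx
    simp only [middleHalfCantor, Set.mem_Icc]
    constructor <;> linarith
  | succ n ih =>
    have key : 4 * x - 3 * (e (N / 4 ^ n) : ℝ) ∈ middleHalfCantor n := by
      apply ih (N % 4 ^ n)
      simp only [cantorCenter, pow_succ, abs_le] at hx ⊢
      constructor <;> linarith
    have h01 : e (N / 4 ^ n) = 0 ∨ e (N / 4 ^ n) = 1 := by have := he (N / 4 ^ n); omega
    rcases h01 with h | h
    · left
      refine ⟨_, key, ?_⟩
      simp [h]
    · right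
      refine ⟨_, key, ?_⟩
      simp [h]

lemma mod_pow_div_pow {a b N : ℕ} (hab : b ≤ a) :
    N % 4 ^ a / 4 ^ b = N / 4 ^ b % 4 ^ (a - b) := by
  obtain ⟨c, rfl⟩ := Nat.exists_eq_add_of_le hab
  rw [pow_add, Nat.mod_mul_right_div_self, Nat.add_sub_cancel_left]

/-- Squares with a common ancestor of side `4 ^ j / 4 ^ n` are close. -/
lemma abs_cantorCenter_sub_le {e : ℕ → ℕ} (he : ∀ d, e d ≤ 1) {n j : ℕ} (hj : j ≤ n) {N N' : ℕ}
    (h : N / 4 ^ j = N' / 4 ^ j) :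
    |cantorCenter e n N - cantorCenter e n N'| ≤ 4 ^ j * (1 / 4) ^ n := by
  induction n generalizing N N' with
  | zero =>
    obtain rfl : j = 0 := by omega
    simp [cantorCenter]
  | succ n ih =>
    rcases Nat.lt_or_ge n j with hlt | hge
    · obtain rfl : j = n + 1 := by omega
      rw [← mul_pow]
      have h1 := cantorCenter_mem_Icc he (n + 1) N
      have h2 := cantorCenter_mem_Icc he (n + 1) N'
      norm_num
      rw [abs_le]
      constructor <;> linarith [h1.1, h1.2, h2.1, h2.2]
    · have htop : N / 4 ^ n = N' / 4 ^ n := by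
        obtain ⟨c, rfl⟩ := Nat.exists_eq_add_of_le hge
        rw [pow_add, ← Nat.div_div_eq_div_mul, ← Nat.div_div_eq_div_mul, h]
      have hrest := ih hge (N := N % 4 ^ n) (N' := N' % 4 ^ n) (by
        rw [mod_pow_div_pow hge, mod_pow_div_pow hge, h])
      simp only [cantorCenter, htop, pow_succ, abs_le] at hrest ⊢
      constructor <;> linarith [hrest.1, hrest.2]

lemma cantorCenter_separated_of_digit_ne {e : ℕ → ℕ} (he : ∀ d, e d ≤ 1) {n N N' : ℕ}
    (h : e (N / 4 ^ n) ≠ e (N' / 4 ^ n)) :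
    1 / 2 ≤ |cantorCenter e (n + 1) N - cantorCenter e (n + 1) N'| := by
  have h1 := cantorCenter_mem_Icc he n (N % 4 ^ n)
  have h2 := cantorCenter_mem_Icc he n (N' % 4 ^ n)
  have ha := he (N / 4 ^ n)
  have hb := he (N' / 4 ^ n)
  simp only [cantorCenter, le_abs]
  have : (e (N / 4 ^ n) = 0 ∧ e (N' / 4 ^ n) = 1) ∨ (e (N / 4 ^ n) = 1 ∧ e (N' / 4 ^ n) = 0) := by
    omega
  rcases this with ⟨h3, h4⟩ | ⟨h3, h4⟩ <;> rw [h3, h4] <;> push_cast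
  · right; linarith [h1.1, h1.2, h2.1, h2.2]
  · left; linarith [h1.1, h1.2, h2.1, h2.2]

/-- Squares without a common ancestor of side `4 ^ j / 4 ^ n` are far apart. -/
lemma squareCenter_separated {n j : ℕ} (hj : j < n) {N N' : ℕ} (hN : N < 4 ^ n) (hN' : N' < 4 ^ n)
    (h : N / 4 ^ j ≠ N' / 4 ^ j) :
    2 * 4 ^ j * (1 / 4) ^ n ≤ |(squareCenter n N).re - (squareCenter n N').re| ∨
    2 * 4 ^ j * (1 / 4) ^ n ≤ |(squareCenter n N).im - (squareCenter n N').im| := by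
  simp only [squareCenter]
  induction n generalizing N N' with
  | zero => omega
  | succ n ih =>
    have hle : (2 : ℝ) * 4 ^ j * (1 / 4) ^ (n + 1) ≤ 1 / 2 := by
      obtain ⟨c, rfl⟩ := Nat.exists_eq_add_of_le (Nat.lt_succ_iff.1 hj)
      have h1 : ((4 : ℝ) ^ j) * (1 / 4) ^ j = 1 := by rw [← mul_pow]; norm_num
      have h2 : ((1 : ℝ) / 4) ^ c ≤ 1 := pow_le_one₀ (by norm_num) (by norm_num)
      calc (2 : ℝ) * 4 ^ j * (1 / 4) ^ (j + c + 1) = 2 * (4 ^ j * (1 / 4) ^ j) * (1 / 4) ^ c / 4 := by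
            ring
        _ ≤ 1 / 2 := by rw [h1]; linarith
    by_cases htop : N / 4 ^ n = N' / 4 ^ n
    · rcases Nat.lt_or_ge j n with hlt | hge
      · have hpos : 0 < 4 ^ n := by positivity
        have hne : N % 4 ^ n / 4 ^ j ≠ N' % 4 ^ n / 4 ^ j := by
          intro heq
          apply h
          obtain ⟨c, rfl⟩ := Nat.exists_eq_add_of_le hlt.le
          rw [mod_pow_div_pow hlt.le, mod_pow_div_pow hlt.le, Nat.add_sub_cancel_left] at heq
          rw [pow_add, ← Nat.div_div_eq_div_mul, ← Nat.div_div_eq_div_mul] at htop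
          rw [← Nat.div_add_mod (N / 4 ^ j) (4 ^ c), heq, htop, Nat.div_add_mod]
        have hrest := ih hlt (Nat.mod_lt N hpos) (Nat.mod_lt N' hpos) hne
        simp only [cantorCenter, htop, pow_succ, le_abs] at hrest ⊢
        rcases hrest with (h1 | h1) | (h1 | h1)
        · left; left; linarith
        · left; right; linarith
        · right; left; linarith
        · right; right; linarith
      · obtain rfl : j = n := by omega
        exact absurd htop h
    · have h4 : N / 4 ^ n < 4 := Nat.div_lt_of_lt_mul (by rwa [pow_succ] at hN)
      have h4' : N' / 4 ^ n < 4 := Nat.div_lt_of_lt_mul (by rwa [pow_succ] at hN')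
      by_cases hd : N / 4 ^ n / 2 = N' / 4 ^ n / 2
      · right
        refine hle.trans (cantorCenter_separated_of_digit_ne (fun d => by omega) ?_)
        omega
      · left
        refine hle.trans (cantorCenter_separated_of_digit_ne (fun d => by omega) ?_)
        omega

/-- In the direction `(-2, 1)` the centres form an arithmetic progression, in the order of their
numbers: the projection of the four-corner set to this line is an interval. -/
lemma squareCenter_projection (n : ℕ) : ∃ K : ℝ, ∀ N < 4 ^ n,
    -2 * (squareCenter n N).re + (squareCenter n N).im = 3 * (1 / 4) ^ n * N + K := by
  simp only [squareCenter]
  induction n with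
  | zero =>
    refine ⟨-1 / 2, fun N hN => ?_⟩
    obtain rfl : N = 0 := by simpa using hN
    simp only [cantorCenter]; norm_num
  | succ n ih =>
    obtain ⟨K, hK⟩ := ih
    refine ⟨(K - 6) / 4, fun N hN => ?_⟩
    have h1 := hK (N % 4 ^ n) (Nat.mod_lt N (by positivity))
    have h4 : N / 4 ^ n < 4 := Nat.div_lt_of_lt_mul (by rwa [pow_succ] at hN)
    have hdig : -2 * ((1 - N / 4 ^ n / 2 : ℕ) : ℝ) + ((N / 4 ^ n % 2 : ℕ) : ℝ)
        = ((N / 4 ^ n : ℕ) : ℝ) - 2 := by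
      generalize N / 4 ^ n = d at h4 ⊢
      interval_cases d <;> norm_num
    have hdm : (N : ℝ) = 4 ^ n * ((N / 4 ^ n : ℕ) : ℝ) + ((N % 4 ^ n : ℕ) : ℝ) := by
      exact_mod_cast (Nat.div_add_mod N (4 ^ n)).symm
    have hq : ((1 : ℝ) / 4) ^ n * 4 ^ n = 1 := by rw [← mul_pow]; norm_num
    simp only [cantorCenter]
    rw [pow_succ, hdm]
    linear_combination (3 / 4) * hdig + h1 / 4 - (3 / 4) * ((N / 4 ^ n : ℕ) : ℝ) * hq

lemma squareCenter_re_mem (n N : ℕ) : (squareCenter n N).re ∈ Set.Icc (0 : ℝ) 1 :=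
  cantorCenter_mem_Icc (fun d => by omega) n N

lemma squareCenter_im_mem (n N : ℕ) : (squareCenter n N).im ∈ Set.Icc (0 : ℝ) 1 :=
  cantorCenter_mem_Icc (fun d => by omega) n N

lemma mem_fourCorner_of_near_center (n N : ℕ) (z : ℂ)
    (hre : |z.re - (squareCenter n N).re| ≤ (1 / 4) ^ n / 2)
    (him : |z.im - (squareCenter n N).im| ≤ (1 / 4) ^ n / 2) : z ∈ fourCorner n :=
  Complex.mem_reProdIm.2
    ⟨mem_middleHalfCantor_of_near_center (fun d => by omega) n N _ hre,
      mem_middleHalfCantor_of_near_center (fun d => by omega) n N _ him⟩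

/-! ### Counting pairs of squares -/

/-- Two numbers are at level `j` if the smallest common ancestor of their squares has side
`4 ^ (j + 1) / 4 ^ n`. -/
def AtLevel (j N N' : ℕ) : Prop := N / 4 ^ j ≠ N' / 4 ^ j ∧ N / 4 ^ (j + 1) = N' / 4 ^ (j + 1)

lemma AtLevel.symm {j N N' : ℕ} (h : AtLevel j N N') : AtLevel j N' N := ⟨h.1.symm, h.2.symm⟩

lemma exists_atLevel {n N N' : ℕ} (hN : N < 4 ^ n) (hN' : N' < 4 ^ n) (hne : N ≠ N') :
    ∃ j < n, AtLevel j N N' := by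
  induction n with
  | zero => simp at hN hN'; omega
  | succ n ih =>
    by_cases h : N / 4 ^ n = N' / 4 ^ n
    · by_contra hcon
      push Not at hcon
      have hall : ∀ i ≤ n, N / 4 ^ (n - i) = N' / 4 ^ (n - i) := by
        intro i hi
        induction i with
        | zero => simpa using h
        | succ i ihi =>
          by_contra hd
          refine hcon (n - (i + 1)) (by omega) ⟨hd, ?_⟩
          have := ihi (by omega)
          rwa [show n - i = n - (i + 1) + 1 by omega] at this
      have := hall n le_rfl
      simp at this
      exact hne this
    · exact ⟨n, by omega, h, by rw [Nat.div_eq_of_lt hN, Nat.div_eq_of_lt hN']⟩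

open Classical in
/-- Pairs at level `j` whose numbers differ by at most `R` are rare: both numbers are within `R` of
a common multiple of `4 ^ j`, on either side of it. -/
lemma card_close_pairs_le {n j : ℕ} (hj : j ≤ n) (R : ℕ) :
    ((Finset.range (4 ^ n) ×ˢ Finset.range (4 ^ n)).filter
      (fun p => AtLevel j p.1 p.2 ∧ p.1 ≤ p.2 + R ∧ p.2 ≤ p.1 + R)).card
      ≤ 2 * (4 ^ (n - j) * R ^ 2) := by
  have hpos : 0 < 4 ^ j := by positivity
  have hhalf : ((Finset.range (4 ^ n) ×ˢ Finset.range (4 ^ n)).filter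
      (fun p => AtLevel j p.1 p.2 ∧ p.2 < p.1 ∧ p.1 ≤ p.2 + R)).card ≤ 4 ^ (n - j) * R ^ 2 := by
    have hcard : (Finset.range (4 ^ (n - j)) ×ˢ (Finset.range R ×ˢ Finset.range R)).card
        = 4 ^ (n - j) * R ^ 2 := by simp [sq]
    rw [← hcard]
    -- `p ↦ (c, p.1 - c * 4 ^ j, c * 4 ^ j - 1 - p.2)` with `c = p.1 / 4 ^ j`
    apply Finset.card_le_card_of_injOn
      (fun p => (p.1 / 4 ^ j, p.1 % 4 ^ j, p.1 / 4 ^ j * 4 ^ j - 1 - p.2))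
    · intro p hp
      simp only [Finset.coe_filter, Finset.mem_product, Finset.mem_range, Set.mem_ofPred_eq] at hp
      obtain ⟨⟨h1, h2⟩, h3, h4, h5⟩ := hp
      have hlt : p.2 < p.1 / 4 ^ j * 4 ^ j := by
        rw [← Nat.div_lt_iff_lt_mul hpos]
        exact lt_of_le_of_ne (Nat.div_le_div_right h4.le) h3.1.symm
      have hdm := Nat.div_add_mod' p.1 (4 ^ j)
      simp only [Finset.coe_product, Finset.coe_range, Set.mem_prod, Set.mem_Iio]
      refine ⟨?_, ?_, ?_⟩
      · apply Nat.div_lt_of_lt_mul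
        rwa [← pow_add, Nat.add_sub_cancel' hj]
      · omega
      · omega
    · rintro ⟨a, b⟩ hp ⟨a', b'⟩ hp' heq
      simp only [Finset.coe_filter, Finset.mem_product, Finset.mem_range, Set.mem_ofPred_eq]
        at hp hp'
      simp only [Prod.mk.injEq] at heq ⊢
      obtain ⟨h1, h2, h3⟩ := heq
      have hlt : b < a / 4 ^ j * 4 ^ j := by
        rw [← Nat.div_lt_iff_lt_mul hpos]
        exact lt_of_le_of_ne (Nat.div_le_div_right hp.2.2.1.le) hp.2.1.1.symm
      have hlt' : b' < a' / 4 ^ j * 4 ^ j := by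
        rw [← Nat.div_lt_iff_lt_mul hpos]
        exact lt_of_le_of_ne (Nat.div_le_div_right hp'.2.2.1.le) hp'.2.1.1.symm
      have hdm := Nat.div_add_mod' a (4 ^ j)
      have hdm' := Nat.div_add_mod' a' (4 ^ j)
      rw [h1] at hlt h3 hdm
      omega
  have hsub : ((Finset.range (4 ^ n) ×ˢ Finset.range (4 ^ n)).filter
      (fun p => AtLevel j p.1 p.2 ∧ p.1 ≤ p.2 + R ∧ p.2 ≤ p.1 + R)) ⊆
      ((Finset.range (4 ^ n) ×ˢ Finset.range (4 ^ n)).filter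
        (fun p => AtLevel j p.1 p.2 ∧ p.2 < p.1 ∧ p.1 ≤ p.2 + R)) ∪
      ((Finset.range (4 ^ n) ×ˢ Finset.range (4 ^ n)).filter
        (fun p => AtLevel j p.1 p.2 ∧ p.2 < p.1 ∧ p.1 ≤ p.2 + R)).image Prod.swap := by
    rintro ⟨a, b⟩ hp
    simp only [Finset.mem_filter, Finset.mem_product, Finset.mem_range, Finset.mem_union,
      Finset.mem_image, Prod.exists, Prod.swap_prod_mk, Prod.mk.injEq] at hp ⊢
    obtain ⟨⟨h1, h2⟩, h3, h4, h5⟩ := hp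
    have hne : a ≠ b := fun h => h3.1 (by rw [h])
    rcases lt_or_gt_of_ne hne with h | h
    · exact Or.inr ⟨b, a, ⟨⟨h2, h1⟩, h3.symm, h, h5⟩, rfl, rfl⟩
    · exact Or.inl ⟨⟨h1, h2⟩, h3, h, h4⟩
  calc _ ≤ _ := Finset.card_le_card hsub
    _ ≤ _ := Finset.card_union_le _ _
    _ ≤ 4 ^ (n - j) * R ^ 2 + 4 ^ (n - j) * R ^ 2 :=
        add_le_add hhalf (Finset.card_image_le.trans hhalf)
    _ = _ := by ring

/-! ### Lines, noodles and the good direction -/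

lemma cwRot_re (θ : ℝ) (z : ℂ) : (cwRot θ z).re = Real.cos θ * z.re + Real.sin θ * z.im := by
  have h : -(θ : ℂ) * Complex.I = ((-θ : ℝ) : ℂ) * Complex.I := by push_cast; ring
  rw [cwRot, h, Complex.mul_re, Complex.exp_ofReal_mul_I_re, Complex.exp_ofReal_mul_I_im,
    Real.cos_neg, Real.sin_neg]
  ring

lemma cwRot_im (θ : ℝ) (z : ℂ) : (cwRot θ z).im = Real.cos θ * z.im - Real.sin θ * z.re := by
  have h : -(θ : ℂ) * Complex.I = ((-θ : ℝ) : ℂ) * Complex.I := by push_cast; ring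
  rw [cwRot, h, Complex.mul_im, Complex.exp_ofReal_mul_I_re, Complex.exp_ofReal_mul_I_im,
    Real.cos_neg, Real.sin_neg]
  ring

lemma cwRot_cwRot (θ s : ℝ) (z : ℂ) : cwRot s (cwRot θ z) = cwRot (θ + s) z := by
  simp only [cwRot]
  rw [← mul_assoc, ← Complex.exp_add]
  congr 2
  push_cast
  ring

lemma cwRot_sub (θ : ℝ) (z w : ℂ) : cwRot θ (z - w) = cwRot θ z - cwRot θ w := mul_sub _ _ _

lemma cwRot_neg_cwRot (θ : ℝ) (z : ℂ) : cwRot θ (cwRot (-θ) z) = z := by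
  rw [cwRot_cwRot]
  simp [cwRot]

/-- The position, in the direction `θ`, to which the shear along the noodle translated by `τ`
moves the point `z`. -/
noncomputable def shadow (g : ℝ → ℝ) (τ θ : ℝ) (z : ℂ) : ℝ :=
  (cwRot θ z).re - g ((cwRot θ z).im - τ)

lemma mem_projSet_shear_iff {g : ℝ → ℝ} {τ θ x : ℝ} {E : Set ℂ} :
    x ∈ projSet θ (shear (translateNoodle g τ) θ '' E) ↔ ∃ z ∈ E, shadow g τ θ z = x := by
  simp only [projSet, shear, Set.image_image, Set.mem_image, Function.comp_apply, cwRot_neg_cwRot,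
    shearZero, translateNoodle, shadow]

/-- The shadow of a square contains an interval of the length of its side about the shadow of
its centre, since a noodle shear does not change lengths along the direction `θ`. -/
lemma mem_projSet_of_near_shadow {g : ℝ → ℝ} {τ θ x : ℝ} (n N : ℕ)
    (h : |x - shadow g τ θ (squareCenter n N)| ≤ (1 / 4) ^ n / 2) :
    x ∈ projSet θ (shear (translateNoodle g τ) θ '' fourCorner n) := by
  rw [mem_projSet_shear_iff]
  set t := x - shadow g τ θ (squareCenter n N) with ht
  have hcs := Real.sin_sq_add_cos_sq θ
  refine ⟨⟨(squareCenter n N).re + t * Real.cos θ, (squareCenter n N).im + t * Real.sin θ⟩,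
    mem_fourCorner_of_near_center n N _ ?_ ?_, ?_⟩
  · rw [add_sub_cancel_left, abs_mul]
    nlinarith [abs_nonneg t, Real.abs_cos_le_one θ]
  · rw [add_sub_cancel_left, abs_mul]
    nlinarith [abs_nonneg t, Real.abs_sin_le_one θ]
  · have hre : (cwRot θ ⟨(squareCenter n N).re + t * Real.cos θ,
        (squareCenter n N).im + t * Real.sin θ⟩).re = (cwRot θ (squareCenter n N)).re + t := by
      rw [cwRot_re, cwRot_re]
      linear_combination t * hcs
    have him : (cwRot θ ⟨(squareCenter n N).re + t * Real.cos θ,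
        (squareCenter n N).im + t * Real.sin θ⟩).im = (cwRot θ (squareCenter n N)).im := by
      rw [cwRot_im, cwRot_im]
      ring
    rw [shadow, hre, him, ht, shadow]
    ring

/-- The direction of `(-2, 1)`, in which the four-corner set projects to an interval. -/
noncomputable def goodAngle : ℝ := Real.pi - Real.arctan (1 / 2)

lemma sqrt_one_add_half_sq : √(1 + (1 / 2 : ℝ) ^ 2) = √5 / 2 := by
  rw [show (1 + (1 / 2 : ℝ) ^ 2) = 5 / 2 ^ 2 by norm_num, Real.sqrt_div (by norm_num),
    Real.sqrt_sq (by norm_num)]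

lemma sqrt_five_mul_cos_goodAngle : √5 * Real.cos goodAngle = -2 := by
  rw [goodAngle, Real.cos_pi_sub, Real.cos_arctan, sqrt_one_add_half_sq]
  have : √(5 : ℝ) ≠ 0 := by positivity
  field_simp

lemma sqrt_five_mul_sin_goodAngle : √5 * Real.sin goodAngle = 1 := by
  rw [goodAngle, Real.sin_pi_sub, Real.sin_arctan, sqrt_one_add_half_sq]
  have : √(5 : ℝ) ≠ 0 := by positivity
  field_simp

lemma goodAngle_mem : goodAngle ∈ Set.Ioo (0 : ℝ) 4 := by
  have h1 := Real.arctan_lt_pi_div_two (1 / 2)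
  have h2 : 0 < Real.arctan (1 / 2) := Real.arctan_pos.2 (by norm_num)
  have h3 := Real.pi_lt_d2
  have h4 := Real.pi_pos
  constructor <;> simp only [goodAngle] <;> linarith

lemma sqrt_five_mem : √(5 : ℝ) ∈ Set.Ioo (2.2 : ℝ) 2.3 :=
  ⟨Real.lt_sqrt_of_sq_lt (by norm_num), (Real.sqrt_lt' (by norm_num)).2 (by norm_num)⟩

lemma sqrt_five_mul_re (z : ℂ) : √5 * (cwRot goodAngle z).re = -2 * z.re + z.im := by
  rw [cwRot_re]
  linear_combination z.re * sqrt_five_mul_cos_goodAngle + z.im * sqrt_five_mul_sin_goodAngle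

lemma sqrt_five_mul_im (z : ℂ) : √5 * (cwRot goodAngle z).im = -z.re - 2 * z.im := by
  rw [cwRot_im]
  linear_combination z.im * sqrt_five_mul_cos_goodAngle - z.re * sqrt_five_mul_sin_goodAngle

/-! ### Pairs of squares with a common shadow -/

lemma half_abs_sub_le_abs_sin_sub {s t : ℝ} (hs : s ∈ Set.Icc (0 : ℝ) (1 / 1024))
    (ht : t ∈ Set.Icc (0 : ℝ) (1 / 1024)) :
    |s - t| / 2 ≤ |Real.sin s - Real.sin t| := by
  wlog hst : t ≤ s generalizing s t
  · rw [abs_sub_comm s, abs_sub_comm (Real.sin s)]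
    exact this ht hs (le_of_not_ge hst)
  obtain ⟨hs0, hs1⟩ := hs
  obtain ⟨ht0, ht1⟩ := ht
  rw [abs_of_nonneg (sub_nonneg.2 hst)]
  refine le_trans ?_ (le_abs_self _)
  rw [Real.sin_sub_sin]
  have h1 : 2 / Real.pi * ((s - t) / 2) ≤ Real.sin ((s - t) / 2) :=
    Real.mul_le_sin (by linarith) (by linarith [Real.pi_gt_three])
  have h2 : 1 - ((s + t) / 2) ^ 2 / 2 ≤ Real.cos ((s + t) / 2) := Real.one_sub_sq_div_two_le_cos
  have h3 : (0.9 : ℝ) ≤ Real.cos ((s + t) / 2) := by nlinarith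
  have h4 : (0.6 : ℝ) ≤ 2 / Real.pi := by
    rw [le_div_iff₀ Real.pi_pos]
    linarith [Real.pi_lt_d2]
  have h5 : 0.6 * ((s - t) / 2) ≤ Real.sin ((s - t) / 2) :=
    le_trans (mul_le_mul_of_nonneg_right h4 (by linarith)) h1
  have h6 : 0 ≤ 0.6 * ((s - t) / 2) := by linarith
  nlinarith [mul_le_mul h5 h3 (by norm_num) (h6.trans h5)]

/-- If two points at relative position `(U, V)` have almost the same shadow in a direction at a
small angle `s` to the horizontal, then `(U, V)` is almost vertical. Here `d` is the difference of
the values of the noodle at the two points. -/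
lemma abs_le_of_near_shadow {U V s κ η d : ℝ} (hκ : κ ≤ 1 / 1024) (hs : s ∈ Set.Icc 0 κ)
    (hd : |d| ≤ κ * |Real.cos s * V - Real.sin s * U|)
    (h : |Real.cos s * U + Real.sin s * V - d| ≤ η) :
    |U| ≤ 2 * (κ * (|U| + 2 * |V|) + η) := by
  obtain ⟨hs0, hs1⟩ := hs
  have hκ0 : 0 ≤ κ := hs0.trans hs1
  have hcos : 1 - s ^ 2 / 2 ≤ Real.cos s := Real.one_sub_sq_div_two_le_cos
  have hcos' : 1 / 2 ≤ Real.cos s := by nlinarith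
  have h1 : |Real.cos s * V - Real.sin s * U| ≤ |V| + |U| := by
    refine (abs_sub _ _).trans ?_
    rw [abs_mul, abs_mul]
    gcongr
    · exact mul_le_of_le_one_left (abs_nonneg _) (Real.abs_cos_le_one s)
    · exact mul_le_of_le_one_left (abs_nonneg _) (Real.abs_sin_le_one s)
  have h2 : |Real.sin s * V| ≤ κ * |V| := by
    rw [abs_mul]
    gcongr
    rw [abs_of_nonneg (Real.sin_nonneg_of_nonneg_of_le_pi hs0 (by linarith [Real.pi_gt_three]))]
    exact (Real.sin_le hs0).trans hs1
  have h3 : |Real.cos s * U| ≤ η + κ * |V| + κ * (|V| + |U|) := by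
    calc |Real.cos s * U|
        = |(Real.cos s * U + Real.sin s * V - d) - Real.sin s * V + d| := by ring_nf
      _ ≤ |Real.cos s * U + Real.sin s * V - d| + |Real.sin s * V| + |d| :=
          (abs_add_le _ _).trans (by gcongr; exact abs_sub _ _)
      _ ≤ _ := by
          gcongr
          exact hd.trans (by gcongr)
  have h4 : |U| / 2 ≤ |Real.cos s * U| := by
    rw [abs_mul, abs_of_nonneg (by linarith : 0 ≤ Real.cos s)]
    nlinarith [abs_nonneg U]
  linarith

/-- Two points at almost vertical relative position `(U, V)` have almost the same shadow only for
angles in a set of small diameter. The noodle need only be Lipschitz, since its argument at one of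
the two points is kept fixed. -/
lemma abs_sub_le_of_near_shadow {g : ℝ → ℝ} {U V s t κ η σ : ℝ} (hκ : κ ≤ 1 / 1024)
    (hg : ∀ a b, |g a - g b| ≤ κ * |a - b|) (hUV : |U| ≤ |V| / 8)
    (hs : s ∈ Set.Icc 0 κ) (ht : t ∈ Set.Icc 0 κ)
    (h : |Real.cos s * U + Real.sin s * V - (g (Real.cos s * V - Real.sin s * U + σ) - g σ)| ≤ η)
    (h' : |Real.cos t * U + Real.sin t * V - (g (Real.cos t * V - Real.sin t * U + σ) - g σ)| ≤ η) :
    |s - t| * |V| ≤ 8 * η := by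
  have hs0 := hs.1
  have hs1 := hs.2
  have hκ0 : 0 ≤ κ := hs0.trans hs1
  have hsin := half_abs_sub_le_abs_sin_sub (s := s) (t := t) ⟨hs0, hs1.trans hκ⟩
    ⟨ht.1, ht.2.trans hκ⟩
  have hsin' := Real.abs_sin_sub_sin_le s t
  have hcos := Real.abs_cos_sub_cos_le s t
  set A := Real.cos s - Real.cos t with hA
  set B := Real.sin s - Real.sin t with hB
  have hgd : |g (Real.cos s * V - Real.sin s * U + σ) - g (Real.cos t * V - Real.sin t * U + σ)|
      ≤ κ * (|s - t| * |V| + |s - t| * |U|) := by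
    refine (hg _ _).trans ?_
    gcongr
    calc _ = |A * V - B * U| := by rw [hA, hB]; ring_nf
      _ ≤ |A| * |V| + |B| * |U| := by rw [← abs_mul, ← abs_mul]; exact abs_sub _ _
      _ ≤ _ := by gcongr
  have hsum : |A * U + B * V -
      (g (Real.cos s * V - Real.sin s * U + σ) - g (Real.cos t * V - Real.sin t * U + σ))|
        ≤ η + η := by
    calc _ = |(Real.cos s * U + Real.sin s * V - (g (Real.cos s * V - Real.sin s * U + σ) - g σ)) -
          (Real.cos t * U + Real.sin t * V - (g (Real.cos t * V - Real.sin t * U + σ) - g σ))| := by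
            rw [hA, hB]; ring_nf
      _ ≤ _ := (abs_sub _ _).trans (add_le_add h h')
  set G := g (Real.cos s * V - Real.sin s * U + σ) - g (Real.cos t * V - Real.sin t * U + σ)
  have h1 : |B * V| ≤ 2 * η + |A * U| + |G| := by
    calc |B * V| = |(A * U + B * V - G) - A * U + G| := by ring_nf
      _ ≤ |A * U + B * V - G| + |A * U| + |G| :=
          (abs_add_le _ _).trans (by gcongr; exact abs_sub _ _)
      _ ≤ _ := by linarith
  have h2 : |A * U| ≤ |s - t| * (|V| / 8) := by rw [abs_mul]; gcongr
  have h3 : |s - t| / 2 * |V| ≤ |B * V| := by rw [abs_mul]; gcongr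
  have h4 : κ * (|s - t| * |V| + |s - t| * |U|) ≤ 1 / 1024 * (|s - t| * |V| + |s - t| * |V|) := by
    have h5 : |U| ≤ |V| := by linarith [abs_nonneg V]
    exact mul_le_mul hκ (add_le_add le_rfl (mul_le_mul_of_nonneg_left h5 (abs_nonneg _)))
      (by positivity) (by norm_num)
  nlinarith [mul_nonneg (abs_nonneg (s - t)) (abs_nonneg V)]

lemma shadow_sub_shadow (g : ℝ → ℝ) (τ s : ℝ) (z w : ℂ) :
    shadow g τ (goodAngle + s) z - shadow g τ (goodAngle + s) w =
      Real.cos s * (cwRot goodAngle (z - w)).re + Real.sin s * (cwRot goodAngle (z - w)).im -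
      (g (Real.cos s * (cwRot goodAngle (z - w)).im - Real.sin s * (cwRot goodAngle (z - w)).re +
        ((cwRot (goodAngle + s) w).im - τ)) - g ((cwRot (goodAngle + s) w).im - τ)) := by
  rw [← cwRot_re, ← cwRot_im, cwRot_cwRot, cwRot_sub, shadow, shadow, Complex.sub_re,
    Complex.sub_im]
  ring_nf

lemma pow_mul_quarter_pow_le (j k : ℕ) : (4 : ℝ) ^ j * (1 / 4) ^ k ≤ 4 ^ (j - k) := by
  have h1 : ((4 : ℝ) ^ k) * (1 / 4) ^ k = 1 := by rw [← mul_pow]; norm_num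
  rcases le_total k j with h | h
  · obtain ⟨c, rfl⟩ := Nat.exists_eq_add_of_le h
    rw [Nat.add_sub_cancel_left, pow_add, mul_right_comm, h1, one_mul]
  · rw [Nat.sub_eq_zero_of_le h, pow_zero]
    calc (4 : ℝ) ^ j * (1 / 4) ^ k ≤ 4 ^ k * (1 / 4) ^ k := by gcongr; norm_num
      _ = 1 := h1

section Pair

variable {g : ℝ → ℝ} {n j k N N' : ℕ}

/-- Two squares at level `j` with overlapping shadows in a direction `κ`-close to the good one are
almost aligned with its normal. -/
lemma abs_re_le_of_common_shadow {κ : ℝ} (hκ : κ ≤ 1 / 1024)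
    (hg : ∀ a b, |g a - g b| ≤ κ * |a - b|) (hj : j < n) (hlev : AtLevel j N N')
    {U V s σ : ℝ} (hU : U = (cwRot goodAngle (squareCenter n N - squareCenter n N')).re)
    (hV : V = (cwRot goodAngle (squareCenter n N - squareCenter n N')).im)
    (hs : s ∈ Set.Icc 0 κ)
    (h : |Real.cos s * U + Real.sin s * V - (g (Real.cos s * V - Real.sin s * U + σ) - g σ)|
      ≤ (1 / 4) ^ n / 8) :
    |U| ≤ (48 * (4 ^ j * κ) + 1 / 4) * (1 / 4) ^ n := by
  have hd : |g (Real.cos s * V - Real.sin s * U + σ) - g σ| ≤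
      κ * |Real.cos s * V - Real.sin s * U| := by
    simpa using hg (Real.cos s * V - Real.sin s * U + σ) σ
  have h1 := abs_le_of_near_shadow hκ hs hd h
  have hκ0 : 0 ≤ κ := hs.1.trans hs.2
  have hre := abs_cantorCenter_sub_le (e := fun d => 1 - d / 2) (fun d => by omega)
    (show j + 1 ≤ n from hj) hlev.2
  have him := abs_cantorCenter_sub_le (e := fun d => d % 2) (fun d => by omega)
    (show j + 1 ≤ n from hj) hlev.2
  have e1 := sqrt_five_mul_re (squareCenter n N - squareCenter n N')
  have e2 := sqrt_five_mul_im (squareCenter n N - squareCenter n N')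
  rw [← hU] at e1
  rw [← hV] at e2
  simp only [squareCenter, Complex.sub_re, Complex.sub_im, pow_succ (4 : ℝ) j] at hre him e1 e2
  set x := cantorCenter (fun d => 1 - d / 2) n N - cantorCenter (fun d => 1 - d / 2) n N'
  set y := cantorCenter (fun d => d % 2) n N - cantorCenter (fun d => d % 2) n N'
  set q : ℝ := (1 / 4) ^ n
  obtain ⟨r1, r2⟩ := sqrt_five_mem
  have hU' : √5 * |U| ≤ 3 * (4 ^ j * 4 * q) := by
    rw [← abs_of_pos (by linarith : 0 < √(5 : ℝ)), ← abs_mul, e1]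
    rw [abs_le] at hre him ⊢
    constructor <;> linarith [hre.1, hre.2, him.1, him.2]
  have hV' : √5 * |V| ≤ 3 * (4 ^ j * 4 * q) := by
    rw [← abs_of_pos (by linarith : 0 < √(5 : ℝ)), ← abs_mul, e2]
    rw [abs_le] at hre him ⊢
    constructor <;> linarith [hre.1, hre.2, him.1, him.2]
  have hU2 : |U| ≤ 8 * (4 ^ j * q) := by nlinarith [abs_nonneg U]
  have hV2 : |V| ≤ 8 * (4 ^ j * q) := by nlinarith [abs_nonneg V]
  have h2 : κ * (|U| + 2 * |V|) ≤ κ * (8 * (4 ^ j * q) + 2 * (8 * (4 ^ j * q))) := by gcongr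
  calc |U| ≤ _ := h1
    _ ≤ 2 * (κ * (8 * (4 ^ j * q) + 2 * (8 * (4 ^ j * q))) + q / 8) := by linarith
    _ = _ := by ring

/-- Overlapping shadows force the numbers of the squares to be close. The subtraction in the
exponent is truncated, so that the bound is constant for `j < k`, where the side of the squares
dominates the width of the window. -/
lemma le_add_of_common_shadow (hk : 5 ≤ k) (hg : ∀ a b, |g a - g b| ≤ (1 / 4) ^ k * |a - b|)
    (hj : j < n) (hN : N < 4 ^ n) (hN' : N' < 4 ^ n) (hlev : AtLevel j N N') {τ s : ℝ}
    (hs : s ∈ Set.Icc 0 ((1 / 4) ^ k))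
    (h : |shadow g τ (goodAngle + s) (squareCenter n N) -
      shadow g τ (goodAngle + s) (squareCenter n N')| ≤ (1 / 4) ^ n / 8) :
    N ≤ N' + 49 * 4 ^ (j - k) ∧ N' ≤ N + 49 * 4 ^ (j - k) := by
  have hκ : ((1 : ℝ) / 4) ^ k ≤ 1 / 1024 :=
    (pow_le_pow_of_le_one (by norm_num) (by norm_num) hk).trans (by norm_num)
  rw [shadow_sub_shadow] at h
  have hU := abs_re_le_of_common_shadow hκ hg hj hlev rfl rfl hs h
  have hpk := pow_mul_quarter_pow_le j k
  obtain ⟨K, hK⟩ := squareCenter_projection n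
  have e1 := sqrt_five_mul_re (squareCenter n N - squareCenter n N')
  rw [Complex.sub_re, Complex.sub_im] at e1
  set U := (cwRot goodAngle (squareCenter n N - squareCenter n N')).re
  have e2 : √5 * U = 3 * (1 / 4) ^ n * ((N : ℝ) - N') := by
    linear_combination e1 + hK N hN - hK N' hN'
  have hq : (0 : ℝ) < (1 / 4) ^ n := by positivity
  obtain ⟨r1, r2⟩ := sqrt_five_mem
  have e3 : 3 * (1 / 4) ^ n * |(N : ℝ) - N'| = √5 * |U| := by
    rw [← abs_of_pos (by linarith : 0 < √(5 : ℝ)), ← abs_mul, e2, abs_mul,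
      abs_of_pos (by positivity : (0 : ℝ) < 3 * (1 / 4) ^ n)]
  -- `48 * 4 ^ (j - k) + 1 / 4`, the bound from `hU` and `hpk`, is at most `49 * 4 ^ (j - k)`
  have hone : (1 : ℝ) ≤ 4 ^ (j - k) := one_le_pow₀ (by norm_num)
  have h5 : 3 * (1 / 4) ^ n * |(N : ℝ) - N'| ≤ 3 * (1 / 4) ^ n * (49 * 4 ^ (j - k)) := by
    rw [e3]
    have h7 : |U| ≤ (49 * 4 ^ (j - k)) * (1 / 4) ^ n := by
      refine hU.trans ?_
      gcongr
      linarith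
    calc √5 * |U| ≤ 3 * |U| := by gcongr; linarith
      _ ≤ 3 * ((49 * 4 ^ (j - k)) * (1 / 4) ^ n) := by gcongr
      _ = _ := by ring
  have h6 := le_of_mul_le_mul_left h5 (by positivity)
  rw [abs_le] at h6
  have c1 : (N : ℝ) ≤ (N' + 49 * 4 ^ (j - k) : ℕ) := by push_cast; linarith [h6.2]
  have c2 : (N' : ℝ) ≤ (N + 49 * 4 ^ (j - k) : ℕ) := by push_cast; linarith [h6.1]
  exact ⟨by exact_mod_cast c1, by exact_mod_cast c2⟩

/-- The angles `s ≤ 4⁻ᵏ` for which the shadows of two squares at level `j` overlap, the position of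
the noodle relative to the second square being held fixed. -/
lemma volume_common_shadow_le (hk : 5 ≤ k) (hg : ∀ a b, |g a - g b| ≤ (1 / 4) ^ k * |a - b|)
    (hj : j < n) (hN : N < 4 ^ n) (hN' : N' < 4 ^ n) (hlev : AtLevel j N N') (σ : ℝ)
    {U V : ℝ} (hU : U = (cwRot goodAngle (squareCenter n N - squareCenter n N')).re)
    (hV : V = (cwRot goodAngle (squareCenter n N - squareCenter n N')).im) :
    volume {s : ℝ | s ∈ Set.Ioo ((1 / 4) ^ (k + 1)) ((1 / 4 : ℝ) ^ k) ∧
      |Real.cos s * U + Real.sin s * V - (g (Real.cos s * V - Real.sin s * U + σ) - g σ)|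
        ≤ (1 / 4) ^ n / 8} ≤ ENNReal.ofReal ((1 / 4) ^ max j k) := by
  have hκ : ((1 : ℝ) / 4) ^ k ≤ 1 / 1024 :=
    (pow_le_pow_of_le_one (by norm_num) (by norm_num) hk).trans (by norm_num)
  have hκ0 : (0 : ℝ) < (1 / 4) ^ (k + 1) := by positivity
  rcases le_total j k with hjk | hkj
  · rw [max_eq_right hjk]
    calc _ ≤ volume (Set.Ioo ((1 / 4) ^ (k + 1)) ((1 / 4 : ℝ) ^ k)) :=
          measure_mono fun s hs => hs.1
      _ ≤ _ := by
          rw [Real.volume_Ioo]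
          exact ENNReal.ofReal_le_ofReal (by linarith)
  · rw [max_eq_left hkj]
    refine (Real.volume_le_diam _).trans (Metric.ediam_le fun s hs t ht => ?_)
    rw [edist_dist, Real.dist_eq]
    apply ENNReal.ofReal_le_ofReal
    have hs' : s ∈ Set.Icc 0 ((1 / 4 : ℝ) ^ k) := ⟨hκ0.le.trans hs.1.1.le, hs.1.2.le⟩
    have ht' : t ∈ Set.Icc 0 ((1 / 4 : ℝ) ^ k) := ⟨hκ0.le.trans ht.1.1.le, ht.1.2.le⟩
    have hUle := abs_re_le_of_common_shadow hκ hg hj hlev hU hV hs' hs.2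
    obtain ⟨r1, r2⟩ := sqrt_five_mem
    have r5 : √(5 : ℝ) * √5 = 5 := Real.mul_self_sqrt (by norm_num)
    have hq : (0 : ℝ) < (1 / 4) ^ n := by positivity
    have h4j : (1024 : ℝ) ≤ 4 ^ j :=
      le_trans (by norm_num) (pow_le_pow_right₀ (by norm_num : (1 : ℝ) ≤ 4) (hk.trans hkj))
    have hUsmall : |U| ≤ 1 / 8 * (4 ^ j * (1 / 4) ^ n) := by
      have : 48 * ((4 : ℝ) ^ j * (1 / 4) ^ k) + 1 / 4 ≤ 1 / 8 * 4 ^ j := by nlinarith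
      calc |U| ≤ _ := hUle
        _ ≤ (1 / 8 * 4 ^ j) * (1 / 4) ^ n := by gcongr
        _ = _ := by ring
    have hVlarge : 4 ^ j * (1 / 4) ^ n ≤ |V| := by
      have e1 := sqrt_five_mul_re (squareCenter n N - squareCenter n N')
      have e2 := sqrt_five_mul_im (squareCenter n N - squareCenter n N')
      rw [← hU, Complex.sub_re, Complex.sub_im] at e1
      rw [← hV, Complex.sub_re, Complex.sub_im] at e2
      have hsep := squareCenter_separated hj hN hN' hlev.1
      set x := (squareCenter n N).re - (squareCenter n N').re
      set y := (squareCenter n N).im - (squareCenter n N').im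
      have ex : √5 * x = -2 * U - V := by
        have : √5 * (√5 * x) = √5 * (-2 * U - V) := by
          linear_combination x * r5 - 2 * (-e1) + e2
        exact mul_left_cancel₀ (by positivity) this
      have ey : √5 * y = U - 2 * V := by
        have : √5 * (√5 * y) = √5 * (U - 2 * V) := by
          linear_combination y * r5 - e1 + 2 * e2
        exact mul_left_cancel₀ (by positivity) this
      have hbig : √5 * (2 * 4 ^ j * (1 / 4) ^ n) ≤ 2 * |U| + 2 * |V| := by
        rcases hsep with hx | hy
        · calc _ ≤ √5 * |x| := by gcongr
            _ = |-2 * U - V| := by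
                rw [← ex, abs_mul, abs_of_pos (by linarith : 0 < √(5 : ℝ))]
            _ ≤ _ := by
                refine (abs_sub _ _).trans ?_
                rw [abs_mul]
                norm_num
                linarith [abs_nonneg V]
        · calc _ ≤ √5 * |y| := by gcongr
            _ = |U - 2 * V| := by
                rw [← ey, abs_mul, abs_of_pos (by linarith : 0 < √(5 : ℝ))]
            _ ≤ _ := by
                refine (abs_sub _ _).trans ?_
                rw [abs_mul]
                norm_num
                linarith [abs_nonneg U]
      have hm : 2.2 * (2 * 4 ^ j * (1 / 4) ^ n) ≤ √5 * (2 * 4 ^ j * (1 / 4 : ℝ) ^ n) := by gcongr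
      have : (0 : ℝ) < 4 ^ j * (1 / 4) ^ n := by positivity
      linarith
    have hfin := abs_sub_le_of_near_shadow hκ hg (by linarith) hs' ht' hs.2 ht.2
    have hpos : (0 : ℝ) < 4 ^ j * (1 / 4) ^ n := by positivity
    have h4 : ((1 : ℝ) / 4) ^ j * 4 ^ j = 1 := by rw [← mul_pow]; norm_num
    have hst : |s - t| * (4 ^ j * (1 / 4) ^ n) ≤ (1 / 4) ^ j * (4 ^ j * (1 / 4) ^ n) := by
      calc _ ≤ |s - t| * |V| := by gcongr
        _ ≤ 8 * ((1 / 4) ^ n / 8) := hfin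
        _ = _ := by rw [← mul_assoc, h4]; ring
    exact le_of_mul_le_mul_right hst hpos

end Pair

/-! ### The second moment method -/

/-- The Cauchy–Schwarz inequality for the number of sets `A i` that contain a random point. -/
lemma sq_sum_measureReal_le {α ι : Type*} [MeasurableSpace α] (μ : Measure α) [IsFiniteMeasure μ]
    (I : Finset ι) (A : ι → Set α) (hA : ∀ i, MeasurableSet (A i)) :
    (∑ i ∈ I, μ.real (A i)) ^ 2 ≤
      μ.real (⋃ i ∈ I, A i) * ∑ i ∈ I, ∑ j ∈ I, μ.real (A i ∩ A j) := by
  set S := ⋃ i ∈ I, A i with hS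
  have hSm : MeasurableSet S := I.measurableSet_biUnion fun i _ => hA i
  have hint : ∀ B : Set α, MeasurableSet B → Integrable (B.indicator (1 : α → ℝ)) μ :=
    fun B hB => (integrable_const (1 : ℝ)).indicator hB
  have hquad : ∀ l : ℝ, 0 ≤ μ.real S * (l * l) + (-2 * ∑ i ∈ I, μ.real (A i)) * l +
      ∑ i ∈ I, ∑ j ∈ I, μ.real (A i ∩ A j) := by
    intro l
    have hpt : ∀ x, (∑ i ∈ I, (A i).indicator (1 : α → ℝ) x - l * S.indicator (1 : α → ℝ) x) ^ 2 =
        (l * l) * S.indicator (1 : α → ℝ) x + (-2 * l) * ∑ i ∈ I, (A i).indicator (1 : α → ℝ) x +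
        ∑ i ∈ I, ∑ j ∈ I, (A i ∩ A j).indicator (1 : α → ℝ) x := by
      intro x
      have h1 : ∑ i ∈ I, ∑ j ∈ I, (A i ∩ A j).indicator (1 : α → ℝ) x =
          (∑ i ∈ I, (A i).indicator (1 : α → ℝ) x) * ∑ j ∈ I, (A j).indicator (1 : α → ℝ) x := by
        rw [Finset.sum_mul_sum]
        simp only [Set.inter_indicator_one, Pi.mul_apply]
      have h2 : (∑ i ∈ I, (A i).indicator (1 : α → ℝ) x) * S.indicator (1 : α → ℝ) x =
          ∑ i ∈ I, (A i).indicator (1 : α → ℝ) x := by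
        rw [Finset.sum_mul]
        refine Finset.sum_congr rfl fun i hi => ?_
        by_cases hx : x ∈ A i
        · have : x ∈ S := Set.mem_biUnion hi hx
          simp [hx, this]
        · simp [hx]
      have h3 : S.indicator (1 : α → ℝ) x * S.indicator (1 : α → ℝ) x =
          S.indicator (1 : α → ℝ) x := by
        by_cases hx : x ∈ S <;> simp [hx]
      rw [h1]
      linear_combination (-2 * l) * h2 + l ^ 2 * h3
    have h0 : 0 ≤ ∫ x, (∑ i ∈ I, (A i).indicator (1 : α → ℝ) x -
        l * S.indicator (1 : α → ℝ) x) ^ 2 ∂μ := integral_nonneg fun x => sq_nonneg _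
    simp_rw [hpt] at h0
    have i1 : Integrable (fun x => (l * l) * S.indicator (1 : α → ℝ) x) μ :=
      (hint S hSm).const_mul _
    have i2 : Integrable (fun x => (-2 * l) * ∑ i ∈ I, (A i).indicator (1 : α → ℝ) x) μ :=
      (integrable_finsetSum _ fun i _ => hint _ (hA i)).const_mul _
    have i3 : Integrable (fun x => ∑ i ∈ I, ∑ j ∈ I, (A i ∩ A j).indicator (1 : α → ℝ) x) μ :=
      integrable_finsetSum _ fun i _ => integrable_finsetSum _ fun j _ =>
        hint _ ((hA i).inter (hA j))
    have i12 : Integrable (fun x => (l * l) * S.indicator (1 : α → ℝ) x +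
        (-2 * l) * ∑ i ∈ I, (A i).indicator (1 : α → ℝ) x) μ := i1.add i2
    rw [integral_add i12 i3, integral_add i1 i2, integral_const_mul, integral_const_mul,
      integral_finsetSum _ fun i _ => hint _ (hA i), integral_indicator_one hSm,
      integral_finsetSum _ fun i _ => integrable_finsetSum _ fun j _ =>
        hint _ ((hA i).inter (hA j))] at h0
    have e1 : ∀ i ∈ I, ∫ x, ∑ j ∈ I, (A i ∩ A j).indicator (1 : α → ℝ) x ∂μ =
        ∑ j ∈ I, μ.real (A i ∩ A j) := by
      intro i _
      rw [integral_finsetSum _ fun j _ => hint _ ((hA i).inter (hA j))]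
      exact Finset.sum_congr rfl fun j _ => integral_indicator_one ((hA i).inter (hA j))
    rw [Finset.sum_congr rfl e1,
      Finset.sum_congr rfl fun i _ => integral_indicator_one (hA i)] at h0
    linarith
  have hd := discrim_le_zero hquad
  rw [discrim] at hd
  linarith

lemma volume_thickened_graph (B : Set (ℝ × ℝ)) (hB : MeasurableSet B) {h : ℝ × ℝ → ℝ}
    (hh : Continuous h) (r : ℝ) :
    volume {p : ℝ × ℝ × ℝ | p.2 ∈ B ∧ |p.1 - h p.2| < r} = ENNReal.ofReal (2 * r) * volume B := by
  have hmeas : MeasurableSet {p : ℝ × ℝ × ℝ | p.2 ∈ B ∧ |p.1 - h p.2| < r} :=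
    (measurable_snd hB).inter
      (isOpen_lt (by fun_prop : Continuous fun p : ℝ × ℝ × ℝ => |p.1 - h p.2|)
        continuous_const).measurableSet
  rw [Measure.volume_eq_prod, Measure.prod_apply_symm hmeas]
  have hslice : ∀ y : ℝ × ℝ,
      volume ((fun x => (x, y)) ⁻¹' {p : ℝ × ℝ × ℝ | p.2 ∈ B ∧ |p.1 - h p.2| < r}) =
        B.indicator (fun _ => ENNReal.ofReal (2 * r)) y := by
    intro y
    by_cases hy : y ∈ B
    · rw [Set.indicator_of_mem hy, ← Real.volume_ball (h y) r]
      congr 1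
      ext x
      simp [hy, Real.dist_eq]
    · rw [Set.indicator_of_notMem hy, show (fun x => (x, y)) ⁻¹'
        {p : ℝ × ℝ × ℝ | p.2 ∈ B ∧ |p.1 - h p.2| < r} = ∅ by ext x; simp [hy], measure_empty]
  simp_rw [hslice]
  rw [lintegral_indicator hB, setLIntegral_const]

/-! ### The strips over the squares -/

/-- The directions at distance between `4⁻ᵏ⁻¹` and `4⁻ᵏ` from the good one. -/
noncomputable def angleWindow (k : ℕ) : Set ℝ :=
  Set.Ioo (goodAngle + (1 / 4) ^ (k + 1)) (goodAngle + (1 / 4) ^ k)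

/-- The part of the event for the square with number `N` that is used in the second moment method:
`θ` ranges over the `k`-th window, and `x` over an eighth of the side of the square. -/
noncomputable def strip (L : ℝ) (g : ℝ → ℝ) (n k N : ℕ) : Set (ℝ × ℝ × ℝ) :=
  {p | p.2 ∈ Set.Ioo (-L) L ×ˢ angleWindow k ∧
    |p.1 - shadow g p.2.1 p.2.2 (squareCenter n N)| < (1 / 4) ^ n / 16}

lemma mem_angleWindow_iff {k : ℕ} {θ : ℝ} :
    θ ∈ angleWindow k ↔ θ - goodAngle ∈ Set.Ioo ((1 / 4) ^ (k + 1)) ((1 / 4 : ℝ) ^ k) := by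
  simp only [angleWindow, Set.mem_Ioo]
  constructor <;> rintro ⟨h1, h2⟩ <;> constructor <;> linarith

lemma measurableSet_angleWindow (k : ℕ) : MeasurableSet (angleWindow k) := measurableSet_Ioo

lemma continuous_shadow {g : ℝ → ℝ} (hg : Continuous g) (z : ℂ) :
    Continuous fun y : ℝ × ℝ => shadow g y.1 y.2 z := by
  simp only [shadow, cwRot_re, cwRot_im]
  fun_prop

lemma measurableSet_strip (L : ℝ) {g : ℝ → ℝ} (hg : Continuous g) (n k N : ℕ) :
    MeasurableSet (strip L g n k N) := by
  have h := continuous_shadow hg (squareCenter n N)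
  refine (measurable_snd (measurableSet_Ioo.prod (measurableSet_angleWindow k))).inter
    (isOpen_lt (Continuous.abs (continuous_fst.sub (h.comp continuous_snd)))
      continuous_const).measurableSet

lemma volume_strip {L : ℝ} (hL : 0 < L) {g : ℝ → ℝ} (hg : Continuous g) (n k N : ℕ) :
    volume (strip L g n k N) =
      ENNReal.ofReal ((3 * L / 16) * ((1 / 4) ^ n * (1 / 4) ^ k)) := by
  rw [strip, volume_thickened_graph _ (measurableSet_Ioo.prod (measurableSet_angleWindow k))
    (continuous_shadow hg _), Measure.volume_eq_prod, Measure.prod_prod, angleWindow,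
    Real.volume_Ioo, Real.volume_Ioo, ← ENNReal.ofReal_mul (by linarith),
    ← ENNReal.ofReal_mul (by positivity)]
  congr 1
  ring

lemma volume_overlap_le {L : ℝ} {g : ℝ → ℝ} {n j k N N' : ℕ} (hk : 5 ≤ k)
    (hgc : Continuous g) (hg : ∀ a b, |g a - g b| ≤ (1 / 4) ^ k * |a - b|)
    (hj : j < n) (hN : N < 4 ^ n) (hN' : N' < 4 ^ n) (hlev : AtLevel j N N') :
    volume {y : ℝ × ℝ | y ∈ Set.Ioo (-L) L ×ˢ angleWindow k ∧
      |shadow g y.1 y.2 (squareCenter n N) - shadow g y.1 y.2 (squareCenter n N')|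
        ≤ (1 / 4) ^ n / 8} ≤
      ENNReal.ofReal ((2 * L + 4) * (1 / 4) ^ max j k) := by
  set U := (cwRot goodAngle (squareCenter n N - squareCenter n N')).re with hU
  set V := (cwRot goodAngle (squareCenter n N - squareCenter n N')).im with hV
  -- `T` is the overlap in the coordinate `σ = v - τ`, the position of the noodle relative to the
  -- second square.
  set T : Set (ℝ × ℝ) := {y | y.1 ∈ Set.Ioo (-L - 2) (L + 2) ∧
    (y.2 - goodAngle) ∈ {s : ℝ | s ∈ Set.Ioo ((1 / 4) ^ (k + 1)) ((1 / 4 : ℝ) ^ k) ∧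
      |Real.cos s * U + Real.sin s * V - (g (Real.cos s * V - Real.sin s * U + y.1) - g y.1)|
        ≤ (1 / 4) ^ n / 8}} with hT
  have hTm : MeasurableSet T := by
    refine (measurable_fst measurableSet_Ioo).inter (MeasurableSet.inter ?_ ?_)
    · exact (measurable_snd.sub_const goodAngle) measurableSet_Ioo
    · exact (isClosed_le (by fun_prop : Continuous fun y : ℝ × ℝ =>
        |Real.cos (y.2 - goodAngle) * U + Real.sin (y.2 - goodAngle) * V -
          (g (Real.cos (y.2 - goodAngle) * V - Real.sin (y.2 - goodAngle) * U + y.1) - g y.1)|)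
        continuous_const).measurableSet
  have hAm : MeasurableSet {y : ℝ × ℝ | y ∈ Set.Ioo (-L) L ×ˢ angleWindow k ∧
      |shadow g y.1 y.2 (squareCenter n N) - shadow g y.1 y.2 (squareCenter n N')|
        ≤ (1 / 4) ^ n / 8} :=
    (measurableSet_Ioo.prod (measurableSet_angleWindow k)).inter
      (isClosed_le ((continuous_shadow hgc _).sub (continuous_shadow hgc _)).abs
        continuous_const).measurableSet
  have hshift : volume {y : ℝ × ℝ | y ∈ Set.Ioo (-L) L ×ˢ angleWindow k ∧
      |shadow g y.1 y.2 (squareCenter n N) - shadow g y.1 y.2 (squareCenter n N')|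
        ≤ (1 / 4) ^ n / 8} ≤ volume T := by
    rw [Measure.volume_eq_prod, Measure.prod_apply_symm hAm, Measure.prod_apply_symm hTm]
    refine lintegral_mono fun θ => ?_
    set v := (cwRot θ (squareCenter n N')).im with hv
    have hv2 : |v| ≤ 2 := by
      have h1 := squareCenter_re_mem n N'
      have h2 := squareCenter_im_mem n N'
      rw [hv, cwRot_im]
      refine (abs_sub _ _).trans ?_
      rw [abs_mul, abs_mul, abs_of_nonneg h1.1, abs_of_nonneg h2.1]
      nlinarith [Real.abs_cos_le_one θ, Real.abs_sin_le_one θ, h1.1, h1.2, h2.1, h2.2]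
    rw [← (Measure.measurePreserving_sub_left volume v).measure_preimage
      (measurable_prodMk_right hTm).nullMeasurableSet]
    refine measure_mono fun τ hτ => ?_
    obtain ⟨⟨h1, h2⟩, h3⟩ := hτ
    rw [abs_le] at hv2
    refine ⟨⟨?_, ?_⟩, mem_angleWindow_iff.1 h2, ?_⟩
    · dsimp only at h1 ⊢
      linarith [h1.1, h1.2]
    · dsimp only at h1 ⊢
      linarith [h1.1, h1.2]
    · have := shadow_sub_shadow g τ (θ - goodAngle) (squareCenter n N) (squareCenter n N')
      rw [add_sub_cancel] at this
      dsimp only at h3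
      rwa [this] at h3
  refine hshift.trans ?_
  rw [Measure.volume_eq_prod, Measure.prod_apply hTm]
  calc _ ≤ ∫⁻ σ, (Set.Ioo (-L - 2) (L + 2)).indicator
          (fun _ => ENNReal.ofReal ((1 / 4) ^ max j k)) σ := by
        refine lintegral_mono fun σ => ?_
        by_cases hσ : σ ∈ Set.Ioo (-L - 2) (L + 2)
        · rw [Set.indicator_of_mem hσ]
          refine le_trans ?_ (volume_common_shadow_le hk hg hj hN hN' hlev σ hU hV)
          rw [← measure_preimage_add_right volume goodAngle]
          refine measure_mono fun θ hθ => ?_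
          have h := hθ.2
          dsimp only at h
          rwa [add_sub_cancel_right] at h
        · rw [Set.indicator_of_notMem hσ]
          refine le_of_eq ?_
          convert measure_empty (μ := volume)
          ext θ
          exact ⟨fun h => hσ h.1, fun h => h.elim⟩
    _ = _ := by
        rw [lintegral_indicator measurableSet_Ioo, setLIntegral_const, Real.volume_Ioo,
          ← ENNReal.ofReal_mul (by positivity)]
        congr 1
        ring

lemma shadow_close_of_mem_strip {L : ℝ} {g : ℝ → ℝ} {n k N N' : ℕ} {p : ℝ × ℝ × ℝ}
    (h : p ∈ strip L g n k N) (h' : p ∈ strip L g n k N') :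
    |shadow g p.2.1 p.2.2 (squareCenter n N) - shadow g p.2.1 p.2.2 (squareCenter n N')|
      ≤ (1 / 4) ^ n / 8 := by
  have h1 := h.2
  have h2 := h'.2
  rw [abs_lt] at h1 h2
  rw [abs_le]
  constructor <;> linarith

lemma volume_strip_inter_le {L : ℝ} {g : ℝ → ℝ} {n j k N N' : ℕ} (hk : 5 ≤ k)
    (hgc : Continuous g) (hg : ∀ a b, |g a - g b| ≤ (1 / 4) ^ k * |a - b|)
    (hj : j < n) (hN : N < 4 ^ n) (hN' : N' < 4 ^ n) (hlev : AtLevel j N N') :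
    volume (strip L g n k N ∩ strip L g n k N') ≤
      ENNReal.ofReal ((1 / 4) ^ n / 8 * ((2 * L + 4) * (1 / 4) ^ max j k)) := by
  have hBm : MeasurableSet {y : ℝ × ℝ | y ∈ Set.Ioo (-L) L ×ˢ angleWindow k ∧
      |shadow g y.1 y.2 (squareCenter n N) - shadow g y.1 y.2 (squareCenter n N')|
        ≤ (1 / 4) ^ n / 8} :=
    (measurableSet_Ioo.prod (measurableSet_angleWindow k)).inter
      (isClosed_le ((continuous_shadow hgc _).sub (continuous_shadow hgc _)).abs
        continuous_const).measurableSet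
  have hthick := volume_thickened_graph _ hBm (continuous_shadow hgc (squareCenter n N))
    ((1 / 4) ^ n / 16)
  rw [ENNReal.ofReal_mul (by positivity)]
  refine le_trans (measure_mono ?_) (hthick.le.trans ?_)
  · exact fun p hp => ⟨⟨hp.1.1, shadow_close_of_mem_strip hp.1 hp.2⟩, hp.1.2⟩
  · rw [show 2 * ((1 / 4 : ℝ) ^ n / 16) = (1 / 4) ^ n / 8 by ring]
    gcongr
    exact volume_overlap_le hk hgc hg hj hN hN' hlev

lemma strip_inter_eq_empty {L : ℝ} {g : ℝ → ℝ} {n j k N N' : ℕ} (hk : 5 ≤ k)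
    (hg : ∀ a b, |g a - g b| ≤ (1 / 4) ^ k * |a - b|)
    (hj : j < n) (hN : N < 4 ^ n) (hN' : N' < 4 ^ n) (hlev : AtLevel j N N')
    (hfar : ¬ (N ≤ N' + 49 * 4 ^ (j - k) ∧ N' ≤ N + 49 * 4 ^ (j - k))) :
    strip L g n k N ∩ strip L g n k N' = ∅ := by
  refine Set.eq_empty_of_forall_notMem fun p hp => hfar ?_
  have hw := mem_angleWindow_iff.1 hp.1.1.2
  have hclose := shadow_close_of_mem_strip hp.1 hp.2
  rw [← add_sub_cancel goodAngle p.2.2] at hclose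
  have h0 : (0 : ℝ) ≤ (1 / 4) ^ (k + 1) := by positivity
  exact le_add_of_common_shadow hk hg hj hN hN' hlev ⟨h0.trans hw.1.le, hw.2.le⟩ hclose

/-- The strips are not cut off by the range `(-2, 2)` of `x`. In the direction `(-2, 1)` the unit
square projects into `[-2 / √5, 1 / √5]`, which leaves room for a noodle with `|g| < 1`; in the
direction `(2, 1)`, where the four-corner set also projects to an interval, this would fail. -/
lemma strip_subset_box {L : ℝ} {g : ℝ → ℝ} (hg1 : ∀ y, |g y| < 1) {n k : ℕ} (hn : 1 ≤ n)
    (hk : 5 ≤ k) (N : ℕ) :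
    strip L g n k N ⊆ Set.Ioo (-2) 2 ×ˢ Set.Ioo (-L) L ×ˢ Set.Ioo 0 (2 * Real.pi) := by
  rintro ⟨x, τ, θ⟩ ⟨⟨hτ, hθ⟩, hx⟩
  dsimp only at hτ hθ hx
  have hw := mem_angleWindow_iff.1 hθ
  have hκ : ((1 : ℝ) / 4) ^ k ≤ 1 / 1024 :=
    (pow_le_pow_of_le_one (by norm_num) (by norm_num) hk).trans (by norm_num)
  have hκ0 : (0 : ℝ) < (1 / 4) ^ (k + 1) := by positivity
  have hq : ((1 : ℝ) / 4) ^ n ≤ 1 / 4 :=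
    (pow_le_pow_of_le_one (by norm_num) (by norm_num) hn).trans (by norm_num)
  obtain ⟨a1, a2⟩ := goodAngle_mem
  have hpi := Real.pi_gt_three
  obtain ⟨r1, r2⟩ := sqrt_five_mem
  obtain ⟨x0, x1⟩ := squareCenter_re_mem n N
  obtain ⟨y0, y1⟩ := squareCenter_im_mem n N
  have e1 := sqrt_five_mul_re (squareCenter n N)
  have e2 := sqrt_five_mul_im (squareCenter n N)
  have hre : (cwRot θ (squareCenter n N)).re =
      Real.cos (θ - goodAngle) * (cwRot goodAngle (squareCenter n N)).re +
      Real.sin (θ - goodAngle) * (cwRot goodAngle (squareCenter n N)).im := by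
    rw [← cwRot_re, cwRot_cwRot, add_sub_cancel]
  set s := θ - goodAngle with hs
  set u := (cwRot goodAngle (squareCenter n N)).re
  set v := (cwRot goodAngle (squareCenter n N)).im
  have hs0 : 0 < s := hκ0.trans hw.1
  have hs1 : s < 1 / 1024 := hw.2.trans_le hκ
  have hu : |u| ≤ 0.92 := by
    rw [abs_le]
    constructor <;> by_contra! hcon <;> nlinarith
  have hv : |v| ≤ 1.5 := by
    rw [abs_le]
    constructor <;> by_contra! hcon <;> nlinarith
  have hsin : |Real.sin s| ≤ 1 / 1024 := by
    rw [abs_of_nonneg (Real.sin_nonneg_of_nonneg_of_le_pi hs0.le (by linarith))]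
    exact (Real.sin_le hs0.le).trans hs1.le
  have hshadow : |(cwRot θ (squareCenter n N)).re| ≤ 0.93 := by
    rw [hre]
    calc _ ≤ |Real.cos s| * |u| + |Real.sin s| * |v| := by
          rw [← abs_mul, ← abs_mul]; exact abs_add_le _ _
      _ ≤ 1 * 0.92 + 1 / 1024 * 1.5 := by
          gcongr
          exact Real.abs_cos_le_one s
      _ ≤ _ := by norm_num
  have hgv := hg1 ((cwRot θ (squareCenter n N)).im - τ)
  rw [abs_le] at hshadow
  rw [abs_lt] at hgv hx
  rw [shadow] at hx
  exact ⟨⟨by dsimp only; linarith [hx.1, hshadow.1, hgv.2],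
    by dsimp only; linarith [hx.2, hshadow.2, hgv.1]⟩, hτ,
    by dsimp only; linarith, by dsimp only; linarith⟩

/-! ### The logarithmic lower bound -/

lemma measureReal_strip {L : ℝ} (hL : 0 < L) {g : ℝ → ℝ} (hg : Continuous g) (n k N : ℕ) :
    volume.real (strip L g n k N) = (3 * L / 16) * ((1 / 4) ^ n * (1 / 4) ^ k) := by
  rw [measureReal_def, volume_strip hL hg, ENNReal.toReal_ofReal (by positivity)]

lemma level_contribution_le {n j : ℕ} (hj : j < n) (k : ℕ) :
    (4 : ℝ) ^ (n - j) * (1 / 4) ^ n * (4 ^ (j - k)) ^ 2 * (1 / 4) ^ max j k ≤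
      (1 / 16) ^ k + (1 / 4) ^ j * (1 / 4) ^ k := by
  have h1 : (4 : ℝ) ^ (n - j) * (1 / 4) ^ n = (1 / 4) ^ j := by
    obtain ⟨c, rfl⟩ := Nat.exists_eq_add_of_le hj.le
    rw [Nat.add_sub_cancel_left, pow_add, mul_left_comm, ← mul_pow]
    norm_num
  rw [h1]
  rcases le_total k j with h | h
  · obtain ⟨c, rfl⟩ := Nat.exists_eq_add_of_le h
    rw [max_eq_left h, Nat.add_sub_cancel_left]
    have h2 : (4 : ℝ) ^ c * (1 / 4) ^ c = 1 := by rw [← mul_pow]; norm_num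
    have h3 : ((1 : ℝ) / 16) ^ k = (1 / 4) ^ k * (1 / 4) ^ k := by rw [← mul_pow]; norm_num
    have h4 : (0 : ℝ) < (1 / 4) ^ (k + c) * (1 / 4) ^ k := by positivity
    calc ((1 : ℝ) / 4) ^ (k + c) * (4 ^ c) ^ 2 * (1 / 4) ^ (k + c)
        = (1 / 4) ^ k * (1 / 4) ^ k * (4 ^ c * (1 / 4) ^ c) ^ 2 := by rw [pow_add]; ring
      _ = (1 / 16) ^ k := by rw [h2, h3]; ring
      _ ≤ _ := by linarith
  · rw [max_eq_right h, Nat.sub_eq_zero_of_le h, pow_zero, one_pow, mul_one]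
    have : (0 : ℝ) < (1 / 16) ^ k := by positivity
    linarith

lemma sum_quarter_pow_le (n : ℕ) : ∑ j ∈ Finset.range n, ((1 : ℝ) / 4) ^ j ≤ 2 := by
  rw [geom_sum_eq (by norm_num)]
  have : (0 : ℝ) < (1 / 4) ^ n := by positivity
  rw [div_le_iff_of_neg (by norm_num)]
  linarith

section SecondMoment

variable {L : ℝ} {g : ℝ → ℝ} {n k : ℕ}

/-- The second moment of the number of strips of the `k`-th window: the total mass of the window is
of order `4⁻ᵏ`, but every level `j ≥ k` contributes only `16⁻ᵏ`. -/
lemma second_moment_le (hL : 0 < L) (hk : 5 ≤ k) (hkn : 4 ^ k ≤ n) (hgc : Continuous g)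
    (hg : ∀ a b, |g a - g b| ≤ (1 / 4) ^ k * |a - b|) :
    ∑ N ∈ Finset.range (4 ^ n), ∑ N' ∈ Finset.range (4 ^ n),
      volume.real (strip L g n k N ∩ strip L g n k N') ≤
      2000 * (2 * L + 4) * (n * (1 / 16) ^ k) := by
  classical
  set I := Finset.range (4 ^ n) with hI
  set q : ℝ := (1 / 4) ^ n with hq
  set a : ℝ := (3 * L / 16) * (q * (1 / 4) ^ k) with ha
  set b : ℕ → ℝ := fun j => q / 8 * ((2 * L + 4) * (1 / 4) ^ max j k) with hb
  have ha0 : 0 ≤ a := by positivity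
  have hb0 : ∀ j, 0 ≤ b j := fun j => by positivity
  have hnq : (4 : ℝ) ^ n * q = 1 := by rw [hq, ← mul_pow]; norm_num
  rw [← Finset.sum_product' I I fun N N' => volume.real (strip L g n k N ∩ strip L g n k N')]
  have hpair : ∀ p ∈ I ×ˢ I, volume.real (strip L g n k p.1 ∩ strip L g n k p.2) ≤
      (if p.1 = p.2 then a else 0) + ∑ j ∈ Finset.range n,
        if AtLevel j p.1 p.2 ∧ p.1 ≤ p.2 + 49 * 4 ^ (j - k) ∧ p.2 ≤ p.1 + 49 * 4 ^ (j - k)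
          then b j else 0 := by
    rintro ⟨N, N'⟩ hp
    simp only [hI, Finset.mem_product, Finset.mem_range] at hp
    obtain ⟨hN, hN'⟩ := hp
    have hsum0 : ∀ j ∈ Finset.range n, 0 ≤ if AtLevel j N N' ∧ N ≤ N' + 49 * 4 ^ (j - k) ∧
        N' ≤ N + 49 * 4 ^ (j - k) then b j else 0 := fun j _ => by
      split_ifs
      exacts [hb0 j, le_rfl]
    dsimp only
    by_cases hne : N = N'
    · subst hne
      rw [Set.inter_self, measureReal_strip hL hgc, if_pos rfl]
      linarith [Finset.sum_nonneg hsum0]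
    · obtain ⟨j, hj, hlev⟩ := exists_atLevel hN hN' hne
      rw [if_neg hne, zero_add]
      refine le_trans ?_ (Finset.single_le_sum hsum0 (Finset.mem_range.2 hj))
      by_cases hc : N ≤ N' + 49 * 4 ^ (j - k) ∧ N' ≤ N + 49 * 4 ^ (j - k)
      · rw [if_pos ⟨hlev, hc⟩, measureReal_def]
        exact ENNReal.toReal_le_of_le_ofReal (hb0 j)
          (volume_strip_inter_le hk hgc hg hj hN hN' hlev)
      · rw [strip_inter_eq_empty hk hg hj hN hN' hlev hc, measureReal_empty]
        exact hsum0 j (Finset.mem_range.2 hj)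
  have hdiag : ∑ p ∈ I ×ˢ I, (if p.1 = p.2 then a else 0) = (3 * L / 16) * (1 / 4) ^ k := by
    rw [Finset.sum_product]
    have : ∀ N ∈ I, ∑ N' ∈ I, (if N = N' then a else 0) = a := fun N hN => by
      rw [Finset.sum_ite_eq, if_pos hN]
    rw [Finset.sum_congr rfl this, Finset.sum_const, hI, Finset.card_range, nsmul_eq_mul, ha]
    push_cast
    linear_combination (3 * L / 16) * (1 / 4) ^ k * hnq
  have hlevel : ∀ j ∈ Finset.range n, ∑ p ∈ I ×ˢ I,
      (if AtLevel j p.1 p.2 ∧ p.1 ≤ p.2 + 49 * 4 ^ (j - k) ∧ p.2 ≤ p.1 + 49 * 4 ^ (j - k)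
          then b j else 0) ≤
      4802 / 8 * (2 * L + 4) * ((1 / 16) ^ k + (1 / 4) ^ j * (1 / 4) ^ k) := by
    intro j hj
    have hj' := Finset.mem_range.1 hj
    rw [← Finset.sum_filter, Finset.sum_const, nsmul_eq_mul]
    have hcard := card_close_pairs_le hj'.le (49 * 4 ^ (j - k))
    have hcard' : (((I ×ˢ I).filter (fun p => AtLevel j p.1 p.2 ∧ p.1 ≤ p.2 + 49 * 4 ^ (j - k) ∧
        p.2 ≤ p.1 + 49 * 4 ^ (j - k))).card : ℝ) ≤
        2 * (4 ^ (n - j) * (49 * 4 ^ (j - k)) ^ 2) := by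
      refine le_trans (Nat.cast_le.2 (le_trans (le_of_eq ?_) hcard)) (by push_cast; rfl)
      congr
    calc _ ≤ 2 * (4 ^ (n - j) * (49 * 4 ^ (j - k)) ^ 2) * b j :=
          mul_le_mul_of_nonneg_right hcard' (hb0 j)
      _ = 4802 / 8 * (2 * L + 4) *
          (4 ^ (n - j) * (1 / 4) ^ n * (4 ^ (j - k)) ^ 2 * (1 / 4) ^ max j k) := by
          rw [hb, hq]; ring
      _ ≤ _ := by
          gcongr
          exact level_contribution_le hj' k
  have hnk : ((1 : ℝ) / 4) ^ k ≤ n * (1 / 16) ^ k := by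
    have h2 : (4 : ℝ) ^ k * (1 / 16) ^ k = (1 / 4) ^ k := by rw [← mul_pow]; norm_num
    rw [← h2]
    gcongr
    exact_mod_cast hkn
  calc _ ≤ ∑ p ∈ I ×ˢ I, ((if p.1 = p.2 then a else 0) + ∑ j ∈ Finset.range n,
        if AtLevel j p.1 p.2 ∧ p.1 ≤ p.2 + 49 * 4 ^ (j - k) ∧ p.2 ≤ p.1 + 49 * 4 ^ (j - k)
          then b j else 0) := Finset.sum_le_sum hpair
    _ = (3 * L / 16) * (1 / 4) ^ k + ∑ j ∈ Finset.range n, ∑ p ∈ I ×ˢ I,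
        (if AtLevel j p.1 p.2 ∧ p.1 ≤ p.2 + 49 * 4 ^ (j - k) ∧ p.2 ≤ p.1 + 49 * 4 ^ (j - k)
          then b j else 0) := by
        rw [Finset.sum_add_distrib, hdiag, Finset.sum_comm]
    _ ≤ (3 * L / 16) * (1 / 4) ^ k + ∑ j ∈ Finset.range n,
        4802 / 8 * (2 * L + 4) * ((1 / 16) ^ k + (1 / 4) ^ j * (1 / 4) ^ k) :=
        add_le_add le_rfl (Finset.sum_le_sum hlevel)
    _ = (3 * L / 16) * (1 / 4) ^ k + 4802 / 8 * (2 * L + 4) *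
        (n * (1 / 16) ^ k + (∑ j ∈ Finset.range n, (1 / 4 : ℝ) ^ j) * (1 / 4) ^ k) := by
        rw [← Finset.mul_sum, Finset.sum_add_distrib, Finset.sum_const, Finset.card_range,
          nsmul_eq_mul, Finset.sum_mul]
    _ ≤ (3 * L / 16) * (n * (1 / 16) ^ k) + 4802 / 8 * (2 * L + 4) *
        (n * (1 / 16) ^ k + 2 * (n * (1 / 16) ^ k)) := by
        gcongr
        exact sum_quarter_pow_le n
    _ ≤ _ := by
        have : (0 : ℝ) ≤ n * (1 / 16) ^ k := by positivity
        nlinarith [mul_nonneg hL.le this]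

/-- Every window contributes at least a constant multiple of `1 / n`. -/
lemma measureReal_iUnion_strip_ge (hL : 0 < L) (hk : 5 ≤ k) (hkn : 4 ^ k ≤ n)
    (hgc : Continuous g) (hg : ∀ a b, |g a - g b| ≤ (1 / 4) ^ k * |a - b|)
    (hg1 : ∀ y, |g y| < 1) :
    (3 * L / 16) ^ 2 / (2000 * (2 * L + 4)) / n ≤
      volume.real (⋃ N ∈ Finset.range (4 ^ n), strip L g n k N) := by
  have hn : 1 ≤ n := le_trans (Nat.one_le_pow _ _ (by norm_num)) hkn
  set box : Set (ℝ × ℝ × ℝ) := Set.Ioo (-2) 2 ×ˢ Set.Ioo (-L) L ×ˢ Set.Ioo 0 (2 * Real.pi)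
  have hboxfin : volume box ≠ ∞ := by
    simp only [box, Measure.volume_eq_prod, Measure.prod_prod, Real.volume_Ioo]
    finiteness
  have : IsFiniteMeasure (volume.restrict box) :=
    ⟨by rw [Measure.restrict_apply_univ]; exact hboxfin.lt_top⟩
  have hrestrict : ∀ A : Set (ℝ × ℝ × ℝ), MeasurableSet A → A ⊆ box →
      (volume.restrict box).real A = volume.real A := fun A hA hAb => by
    rw [measureReal_restrict_apply hA, Set.inter_eq_left.2 hAb]
  have hm := fun N => measurableSet_strip L hgc n k N
  have hb := fun N => strip_subset_box (L := L) hg1 hn hk N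
  have hcs := sq_sum_measureReal_le (volume.restrict box) (Finset.range (4 ^ n))
    (fun N => strip L g n k N) hm
  simp_rw [fun N => hrestrict _ (hm N) (hb N),
    fun N N' => hrestrict _ ((hm N).inter (hm N')) (Set.inter_subset_left.trans (hb N)),
    hrestrict _ (Finset.measurableSet_biUnion _ fun N _ => hm N)
      (Set.iUnion₂_subset fun N _ => hb N), measureReal_strip hL hgc] at hcs
  rw [Finset.sum_const, Finset.card_range, nsmul_eq_mul] at hcs
  have hnq : (4 : ℝ) ^ n * (1 / 4) ^ n = 1 := by rw [← mul_pow]; norm_num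
  have h16 : ((1 : ℝ) / 4) ^ k * (1 / 4) ^ k = (1 / 16) ^ k := by rw [← mul_pow]; norm_num
  have hmass : ((4 ^ n : ℕ) : ℝ) * (3 * L / 16 * ((1 / 4) ^ n * (1 / 4) ^ k)) =
      3 * L / 16 * (1 / 4) ^ k := by
    push_cast
    linear_combination (3 * L / 16) * (1 / 4) ^ k * hnq
  rw [hmass] at hcs
  have hsm := second_moment_le hL hk hkn hgc hg
  set m := volume.real (⋃ N ∈ Finset.range (4 ^ n), strip L g n k N)
  have hm0 : 0 ≤ m := measureReal_nonneg
  have hn0 : (0 : ℝ) < n := by exact_mod_cast hn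
  have hfin : (3 * L / 16) ^ 2 * (1 / 16) ^ k ≤
      m * (2000 * (2 * L + 4) * n) * (1 / 16) ^ k := by
    calc (3 * L / 16) ^ 2 * (1 / 16) ^ k = (3 * L / 16 * (1 / 4) ^ k) ^ 2 := by
          rw [← h16]; ring
      _ ≤ _ := hcs
      _ ≤ m * (2000 * (2 * L + 4) * (n * (1 / 16) ^ k)) := by gcongr
      _ = _ := by ring
  rw [div_div, div_le_iff₀ (by positivity)]
  exact le_of_mul_le_mul_right hfin (by positivity)

lemma disjoint_angleWindow {k l : ℕ} (h : k < l) : Disjoint (angleWindow k) (angleWindow l) := by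
  rw [Set.disjoint_left]
  intro θ hk hl
  have : ((1 : ℝ) / 4) ^ l ≤ (1 / 4) ^ (k + 1) :=
    pow_le_pow_of_le_one (by norm_num) (by norm_num) h
  linarith [hk.1, hl.2]

lemma strip_subset_event (L : ℝ) (g : ℝ → ℝ) (n k N : ℕ) :
    strip L g n k N ⊆ {p : ℝ × ℝ × ℝ |
      p.1 ∈ projSet p.2.2 (shear (translateNoodle g p.2.1) p.2.2 '' fourCorner n)} := by
  intro p hp
  have hq : (0 : ℝ) < (1 / 4) ^ n := by positivity
  exact mem_projSet_of_near_shadow n N (hp.2.le.trans (by linarith))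

lemma measureReal_div_le_buffonNoodle (hL : 0 < L) {A : Set (ℝ × ℝ × ℝ)} {E : Set ℂ}
    (hbox : A ⊆ Set.Ioo (-2) 2 ×ˢ Set.Ioo (-L) L ×ˢ Set.Ioo 0 (2 * Real.pi))
    (hA : A ⊆ {p : ℝ × ℝ × ℝ | p.1 ∈ projSet p.2.2 (shear (translateNoodle g p.2.1) p.2.2 '' E)}) :
    volume.real A / (16 * Real.pi * L) ≤ buffonNoodle L g E := by
  have hvol : volume (Set.Ioo (-2 : ℝ) 2 ×ˢ Set.Ioo (-L) L ×ˢ Set.Ioo 0 (2 * Real.pi)) =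
      ENNReal.ofReal (16 * Real.pi * L) := by
    rw [Measure.volume_eq_prod, Measure.prod_prod, Measure.volume_eq_prod, Measure.prod_prod,
      Real.volume_Ioo, Real.volume_Ioo, Real.volume_Ioo, ← ENNReal.ofReal_mul (by linarith),
      ← ENNReal.ofReal_mul (by norm_num)]
    congr 1
    ring
  have hpos : 0 < 16 * Real.pi * L := by have := Real.pi_pos; positivity
  rw [buffonNoodle, noodleLaw, measureReal_def (μ := ProbabilityTheory.cond _ _),
    ProbabilityTheory.cond_apply
      (measurableSet_Ioo.prod (measurableSet_Ioo.prod measurableSet_Ioo)), ENNReal.toReal_mul,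
    ENNReal.toReal_inv, hvol, ENNReal.toReal_ofReal hpos.le, div_eq_inv_mul]
  gcongr
  rw [measureReal_def]
  refine ENNReal.toReal_mono ?_ (measure_mono (Set.subset_inter hbox hA))
  exact measure_ne_top_of_subset Set.inter_subset_left (by rw [hvol]; finiteness)

/-- A single square already gives a bound for a fixed generation. -/
lemma quarter_pow_le_buffonNoodle (hL : 0 < L) (hn : 1 ≤ n) (hgc : Continuous g)
    (hg1 : ∀ y, |g y| < 1) :
    (3 * L / 16) * ((1 / 4) ^ n * (1 / 4) ^ 5) / (16 * Real.pi * L) ≤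
      buffonNoodle L g (fourCorner n) := by
  rw [← measureReal_strip hL hgc n 5 0]
  exact measureReal_div_le_buffonNoodle hL (strip_subset_box hg1 hn le_rfl 0)
    (strip_subset_event L g n 5 0)

/-- The windows `5 ≤ k ≤ log₄ n` are disjoint, so that their contributions add up. -/
lemma log_div_le_buffonNoodle (hL : 0 < L) (hn : 4 ^ 10 ≤ n) (hgc : Continuous g)
    (hg : ∀ a b, |g a - g b| ≤ 1 / n * |a - b|) (hg1 : ∀ y, |g y| < 1) :
    (3 * L / 16) ^ 2 / (2000 * (2 * L + 4)) / 4 / (16 * Real.pi * L) * (Real.log n / n) ≤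
      buffonNoodle L g (fourCorner n) := by
  have hn0 : n ≠ 0 := by rintro rfl; norm_num at hn
  have hn1 : 1 ≤ n := Nat.one_le_iff_ne_zero.2 hn0
  have hnpos : (0 : ℝ) < n := by exact_mod_cast hn1
  set K := Nat.log 4 n with hK
  have hKn : 4 ^ K ≤ n := Nat.pow_log_le_self 4 hn0
  have hK10 : 10 ≤ K := by
    have := Nat.log_mono_right (b := 4) hn
    rwa [Nat.log_pow (by norm_num)] at this
  set c := (3 * L / 16) ^ 2 / (2000 * (2 * L + 4)) with hc
  have hc0 : 0 < c := by positivity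
  set W : ℕ → Set (ℝ × ℝ × ℝ) := fun k => ⋃ N ∈ Finset.range (4 ^ n), strip L g n k N with hW
  have hWbox : ∀ k, 5 ≤ k →
      W k ⊆ Set.Ioo (-2) 2 ×ˢ Set.Ioo (-L) L ×ˢ Set.Ioo 0 (2 * Real.pi) := fun k hk =>
    Set.iUnion₂_subset fun N _ => strip_subset_box hg1 hn1 hk N
  have hboxfin : volume (Set.Ioo (-2 : ℝ) 2 ×ˢ Set.Ioo (-L) L ×ˢ Set.Ioo 0 (2 * Real.pi)) ≠ ∞ := by
    simp only [Measure.volume_eq_prod, Measure.prod_prod, Real.volume_Ioo]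
    finiteness
  have hWm : ∀ k, MeasurableSet (W k) := fun k =>
    Finset.measurableSet_biUnion _ fun N _ => measurableSet_strip L hgc n k N
  have hdisj : (↑(Finset.Icc 5 K) : Set ℕ).PairwiseDisjoint W := by
    have hlt : ∀ k l, k < l → Disjoint (W k) (W l) := fun k l hkl => by
      rw [Set.disjoint_left]
      intro p hk hl
      simp only [hW, Set.mem_iUnion] at hk hl
      obtain ⟨N, -, hk⟩ := hk
      obtain ⟨N', -, hl⟩ := hl
      exact Set.disjoint_left.1 (disjoint_angleWindow hkl) hk.1.2 hl.1.2
    intro k _ l _ hne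
    rcases lt_or_gt_of_ne hne with h | h
    · exact hlt k l h
    · exact (hlt l k h).symm
  have hsum : (K - 4 : ℝ) * (c / n) ≤ volume.real (⋃ k ∈ Finset.Icc 5 K, W k) := by
    rw [measureReal_biUnion_finset hdisj (fun k _ => hWm k)
      fun k hk => measure_ne_top_of_subset (hWbox k (Finset.mem_Icc.1 hk).1) hboxfin]
    have hcard : ((Finset.Icc 5 K).card : ℝ) = K - 4 := by
      rw [Nat.card_Icc, Nat.cast_sub (by omega)]
      push_cast
      ring
    rw [← hcard, ← nsmul_eq_mul]
    refine Finset.card_nsmul_le_sum _ _ _ fun k hk => ?_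
    obtain ⟨hk5, hkK⟩ := Finset.mem_Icc.1 hk
    have hkn : 4 ^ k ≤ n := (Nat.pow_le_pow_right (by norm_num) hkK).trans hKn
    refine measureReal_iUnion_strip_ge hL hk5 hkn hgc (fun a b => (hg a b).trans ?_) hg1
    gcongr
    rw [one_div_pow]
    exact one_div_le_one_div_of_le (by positivity) (by exact_mod_cast hkn)
  have hlog : Real.log n ≤ 4 * (K - 4 : ℝ) := by
    have h1 : (n : ℝ) ≤ 4 ^ (K + 1) := by
      exact_mod_cast (Nat.lt_pow_succ_log_self (by norm_num) n).le
    have h2 : Real.log n ≤ (K + 1) * Real.log 4 := by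
      have := Real.log_le_log hnpos h1
      rw [Real.log_pow] at this
      exact_mod_cast this
    have h3 : Real.log 4 ≤ 1.4 := by
      rw [show (4 : ℝ) = 2 ^ 2 by norm_num, Real.log_pow]
      have := Real.log_two_lt_d9
      push_cast
      linarith
    have h4 : (10 : ℝ) ≤ K := by exact_mod_cast hK10
    nlinarith
  have hpos : 0 < 16 * Real.pi * L := by have := Real.pi_pos; positivity
  refine le_trans ?_ (measureReal_div_le_buffonNoodle hL
    (A := ⋃ k ∈ Finset.Icc 5 K, W k)
    (Set.iUnion₂_subset fun k hk => hWbox k (Finset.mem_Icc.1 hk).1)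
    (Set.iUnion₂_subset fun k _ => Set.iUnion₂_subset fun N _ => strip_subset_event L g n k N))
  calc c / 4 / (16 * Real.pi * L) * (Real.log n / n)
      = (Real.log n / 4) * (c / n) / (16 * Real.pi * L) := by ring
    _ ≤ (K - 4 : ℝ) * (c / n) / (16 * Real.pi * L) := by
        gcongr
        linarith
    _ ≤ _ := by gcongr

end SecondMoment

/-- All noodles with exponentially small slope are undercooked with a common constant. -/
lemma exists_undercooked_of_deriv_pow_six_le {L : ℝ} (hL : 0 < L) :
    ∃ C : ℝ, 0 < C ∧ ∀ n : ℕ, 1 ≤ n → ∀ g : ℝ → ℝ, Differentiable ℝ g → (∀ y, |g y| < 1) →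
      (∀ y, |deriv g y| ^ 6 ≤ 8 * (1 / 4) ^ n) →
      C * (Real.log n / n) ≤ buffonNoodle L g (fourCorner n) := by
  have hlim : Filter.Tendsto (fun n : ℕ => 8 * ((n : ℝ) ^ 6 * (1 / 4) ^ n)) Filter.atTop
      (nhds (8 * 0)) :=
    (tendsto_pow_const_mul_const_pow_of_abs_lt_one 6
      (by rw [abs_of_pos] <;> norm_num : |(1 / 4 : ℝ)| < 1)).const_mul 8
  rw [mul_zero] at hlim
  obtain ⟨M, hM⟩ := Filter.eventually_atTop.1 (hlim.eventually (eventually_le_nhds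
    (zero_lt_one : (0 : ℝ) < 1)))
  have hpi := Real.pi_pos
  set c₁ := (3 * L / 16) ^ 2 / (2000 * (2 * L + 4)) / 4 / (16 * Real.pi * L) with hc₁
  set c₂ := (3 * L / 16) * ((1 / 4) ^ (M + 4 ^ 10) * (1 / 4) ^ 5) / (16 * Real.pi * L) with hc₂
  have hc₁0 : 0 < c₁ := by positivity
  have hc₂0 : 0 < c₂ := by rw [hc₂]; positivity
  refine ⟨min c₁ c₂, lt_min hc₁0 hc₂0, fun n hn g hgd hg1 hg' => ?_⟩
  have hn0 : (0 : ℝ) < n := by exact_mod_cast hn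
  have hlog0 : 0 ≤ Real.log n / n := div_nonneg (Real.log_natCast_nonneg n) hn0.le
  rcases le_or_gt (M + 4 ^ 10) n with hbig | hsmall
  · refine (mul_le_mul_of_nonneg_right (min_le_left _ _) hlog0).trans
      (log_div_le_buffonNoodle hL (le_trans (Nat.le_add_left _ _) hbig) hgd.continuous ?_ hg1)
    have hder : ∀ y, ‖deriv g y‖ ≤ 1 / n := fun y => by
      rw [Real.norm_eq_abs]
      refine le_of_pow_le_pow_left₀ (n := 6) (by norm_num) (by positivity) ((hg' y).trans ?_)
      rw [one_div_pow (n : ℝ), le_div_iff₀ (by positivity)]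
      have := hM n (le_trans (Nat.le_add_right _ _) hbig)
      linarith
    intro a b
    have := Convex.norm_image_sub_le_of_norm_deriv_le (s := Set.univ) (fun y _ => hgd y)
      (fun y _ => hder y) convex_univ (Set.mem_univ b) (Set.mem_univ a)
    simpa only [Real.norm_eq_abs] using this
  · have hlog1 : Real.log n / n ≤ 1 := by
      rw [div_le_one hn0]
      exact (Real.log_le_sub_one_of_pos hn0).trans (by linarith)
    calc min c₁ c₂ * (Real.log n / n) ≤ c₂ * 1 := by
          gcongr
          exact min_le_right _ _
      _ = c₂ := mul_one _
      _ ≤ (3 * L / 16) * ((1 / 4) ^ n * (1 / 4) ^ 5) / (16 * Real.pi * L) := by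
          rw [hc₂]
          gcongr ?_ * (?_ * _) / _
          exact pow_le_pow_of_le_one (by norm_num) (by norm_num) hsmall.le
      _ ≤ _ := quarter_pow_le_buffonNoodle hL hn hgd.continuous hg1

/-! ### Noodles with small slope -/

/-- Landau's inequality between a bounded function and its first two derivatives. -/
lemma sq_deriv_le_of_abs_deriv_deriv_le {g : ℝ → ℝ} (hg : Differentiable ℝ g)
    (hg' : Differentiable ℝ (deriv g)) (hg1 : ∀ y, |g y| < 1) {B : ℝ}
    (hB : ∀ y, |deriv (deriv g) y| ≤ B) (y : ℝ) : |deriv g y| ^ 2 ≤ 8 * B := by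
  have hB0 : 0 ≤ B := (abs_nonneg _).trans (hB y)
  have hquad : ∀ h : ℝ, 0 ≤ B * (h * h) + (-|deriv g y|) * h + 2 := by
    intro h
    -- for `h ≤ 0` every term is nonnegative; for `h > 0` compare `g` at `y` and `y + h`
    rcases le_or_gt h 0 with hneg | hpos
    · nlinarith [mul_nonneg hB0 (mul_self_nonneg h), abs_nonneg (deriv g y)]
    obtain ⟨ξ, hξ, hmv⟩ := exists_deriv_eq_slope g (show y < y + h by linarith)
      hg.continuous.continuousOn hg.differentiableOn
    rw [add_sub_cancel_left, eq_div_iff hpos.ne'] at hmv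
    have h1 : |deriv g y - deriv g ξ| ≤ B * |y - ξ| := by
      have := Convex.norm_image_sub_le_of_norm_deriv_le (s := Set.univ) (fun z _ => hg' z)
        (fun z _ => hB z) convex_univ (Set.mem_univ ξ) (Set.mem_univ y)
      simpa only [Real.norm_eq_abs] using this
    have h2 : |y - ξ| ≤ h := by
      rw [abs_le]
      constructor <;> linarith [hξ.1, hξ.2]
    have h3 : |deriv g ξ| * h ≤ 2 := by
      rw [← abs_of_pos hpos, ← abs_mul, hmv]
      exact (abs_sub _ _).trans (by linarith [hg1 (y + h), hg1 y])
    have h4 : |deriv g y| ≤ |deriv g ξ| + B * h := by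
      have := abs_sub_abs_le_abs_sub (deriv g y) (deriv g ξ)
      have := mul_le_mul_of_nonneg_left h2 hB0
      linarith
    nlinarith
  have hd := discrim_le_zero hquad
  rw [discrim] at hd
  nlinarith

lemma four_rpow_neg_natCast (n : ℕ) : (4 : ℝ) ^ (-(n : ℝ)) = (1 / 4) ^ n := by
  rw [Real.rpow_neg (by norm_num), Real.rpow_natCast, one_div, inv_pow]

lemma pow_six_le_of_le_rpow {a t : ℝ} (ha : 0 ≤ a) (n : ℕ) (ht : 1 ≤ 6 * t)
    (h : a ≤ (4 : ℝ) ^ (-(n : ℝ) * t)) : a ^ 6 ≤ 8 * (1 / 4) ^ n := by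
  have h1 : (0 : ℝ) < (1 / 4) ^ n := by positivity
  calc a ^ 6 ≤ ((4 : ℝ) ^ (-(n : ℝ) * t)) ^ 6 := by gcongr
    _ = (4 : ℝ) ^ (-(n : ℝ) * t * (6 : ℕ)) := by
        rw [Real.rpow_mul (by norm_num) (_ * _), Real.rpow_natCast]
    _ ≤ (4 : ℝ) ^ (-(n : ℝ)) := by
        apply Real.rpow_le_rpow_of_exponent_le (by norm_num)
        push_cast
        nlinarith [Nat.cast_nonneg (α := ℝ) n]
    _ = (1 / 4) ^ n := four_rpow_neg_natCast n
    _ ≤ _ := by linarith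

lemma ofReal_abs_le_supNorm (f : ℝ → ℝ) (y : ℝ) : ENNReal.ofReal |f y| ≤ supNorm f :=
  le_iSup (fun y => ENNReal.ofReal |f y|) y

lemma deriv_pow_six_le_of_supNorm {g : ℝ → ℝ} {n : ℕ} (hg : Differentiable ℝ g)
    (hg' : Differentiable ℝ (deriv g)) (hg1 : ∀ y, |g y| < 1)
    (h : supNorm (deriv g) ^ 4 * supNorm (deriv (deriv g)) <
      ENNReal.ofReal ((4 : ℝ) ^ (-(n : ℝ)))) (y : ℝ) :
    |deriv g y| ^ 6 ≤ 8 * (1 / 4) ^ n := by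
  rw [four_rpow_neg_natCast] at h
  have hq : (0 : ℝ) < (1 / 4) ^ n := by positivity
  have hy := ofReal_abs_le_supNorm (deriv g) y
  by_cases htop : supNorm (deriv (deriv g)) = ∞
  · -- the product is finite only as `0 * ∞`, for a constant noodle
    have hzero : supNorm (deriv g) = 0 := by
      by_contra hne
      rw [htop, ENNReal.mul_top (pow_ne_zero 4 hne)] at h
      exact not_top_lt h
    rw [hzero, nonpos_iff_eq_zero, ENNReal.ofReal_eq_zero] at hy
    rw [le_antisymm hy (abs_nonneg _)]
    norm_num
  · set B := (supNorm (deriv (deriv g))).toReal with hBdef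
    have hB : ∀ z, |deriv (deriv g) z| ≤ B := fun z =>
      (ENNReal.ofReal_le_iff_le_toReal htop).1 (ofReal_abs_le_supNorm _ z)
    have hB0 : 0 ≤ B := ENNReal.toReal_nonneg
    have hland := sq_deriv_le_of_abs_deriv_deriv_le hg hg' hg1 hB y
    have hprod : |deriv g y| ^ 4 * B ≤ (1 / 4) ^ n := by
      rw [← ENNReal.ofReal_le_ofReal_iff hq.le, ENNReal.ofReal_mul (by positivity),
        ENNReal.ofReal_pow (abs_nonneg _), hBdef, ENNReal.ofReal_toReal htop]
      exact le_trans (by gcongr) h.le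
    calc |deriv g y| ^ 6 = |deriv g y| ^ 4 * |deriv g y| ^ 2 := by ring
      _ ≤ |deriv g y| ^ 4 * (8 * B) := by gcongr
      _ = 8 * (|deriv g y| ^ 4 * B) := by ring
      _ ≤ _ := by gcongr

theorem mainTheorem3 (L : ℝ) (hL : 10 < L) :
    ∃ C : ℝ, 0 < C ∧
      -- bounds on the noodle and its first two derivatives
      (∀ g : ℕ → ℝ → ℝ,
        (∀ n : ℕ, 1 ≤ n →
          Differentiable ℝ (g n) ∧ Differentiable ℝ (deriv (g n)) ∧
          ∀ y : ℝ, |g n y| < 1 ∧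
            |deriv (g n) y| < (4 : ℝ) ^ (-(n : ℝ) / 5) ∧
            |deriv (deriv (g n)) y| < (4 : ℝ) ^ (-(n : ℝ) / 5)) →
        UndercookedWith L C g) ∧
      -- a stronger bound on the first derivative alone
      (∀ g : ℕ → ℝ → ℝ,
        (∀ n : ℕ, 1 ≤ n →
          Differentiable ℝ (g n) ∧
          ∀ y : ℝ, |g n y| < 1 ∧ |deriv (g n) y| < (4 : ℝ) ^ (-(n : ℝ))) →
        UndercookedWith L C g) ∧
      -- the relaxed condition
      (∀ g : ℕ → ℝ → ℝ,
        (∀ n : ℕ, 1 ≤ n →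
          Differentiable ℝ (g n) ∧ Differentiable ℝ (deriv (g n)) ∧
          (∀ y : ℝ, |g n y| < 1 ∧ |deriv (g n) y| < 1 / 100) ∧
          supNorm (deriv (g n)) ^ 4 * supNorm (deriv (deriv (g n))) <
            ENNReal.ofReal ((4 : ℝ) ^ (-(n : ℝ)))) →
        UndercookedWith L C g) ∧
      -- the example
      UndercookedWith L C
        (fun n y => (4 : ℝ) ^ (-(n : ℝ) / 2) * Real.sin ((4 : ℝ) ^ ((n : ℝ) / 4) * y)) := by
  obtain ⟨C, hC, hcore⟩ := exists_undercooked_of_deriv_pow_six_le (by linarith : 0 < L)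
  refine ⟨C, hC, fun g hg n hn => ?_, fun g hg n hn => ?_, fun g hg n hn => ?_, fun n hn => ?_⟩
  · obtain ⟨hd, -, hb⟩ := hg n hn
    refine hcore n hn (g n) hd (fun y => (hb y).1) fun y =>
      pow_six_le_of_le_rpow (t := 1 / 5) (abs_nonneg _) n (by norm_num) ?_
    rw [mul_one_div]
    exact (hb y).2.1.le
  · obtain ⟨hd, hb⟩ := hg n hn
    refine hcore n hn (g n) hd (fun y => (hb y).1) fun y =>
      pow_six_le_of_le_rpow (t := 1) (abs_nonneg _) n (by norm_num) ?_
    rw [mul_one]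
    exact (hb y).2.le
  · obtain ⟨hd, hd', hb, hsup⟩ := hg n hn
    exact hcore n hn (g n) hd (fun y => (hb y).1)
      (deriv_pow_six_le_of_supNorm hd hd' (fun y => (hb y).1) hsup)
  · have hn' : (1 : ℝ) ≤ n := by exact_mod_cast hn
    refine hcore n hn _ (by fun_prop) (fun y => ?_) fun y =>
      pow_six_le_of_le_rpow (t := 1 / 4) (abs_nonneg _) n (by norm_num) ?_
    · rw [abs_mul, abs_of_pos (by positivity)]
      calc _ ≤ (4 : ℝ) ^ (-(n : ℝ) / 2) * 1 := by
            gcongr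
            exact Real.abs_sin_le_one _
        _ < 1 := by
            rw [mul_one]
            exact Real.rpow_lt_one_of_one_lt_of_neg (by norm_num) (by linarith)
    · have hder : HasDerivAt
          (fun y => (4 : ℝ) ^ (-(n : ℝ) / 2) * Real.sin ((4 : ℝ) ^ ((n : ℝ) / 4) * y))
          ((4 : ℝ) ^ (-(n : ℝ) / 2) *
            (Real.cos ((4 : ℝ) ^ ((n : ℝ) / 4) * y) * ((4 : ℝ) ^ ((n : ℝ) / 4) * 1))) y :=
        (((hasDerivAt_id y).const_mul _).sin).const_mul _
      rw [hder.deriv, abs_mul, abs_mul, mul_one, abs_of_pos (by positivity),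
        abs_of_pos (a := (4 : ℝ) ^ ((n : ℝ) / 4)) (by positivity)]
      calc _ ≤ (4 : ℝ) ^ (-(n : ℝ) / 2) * (1 * (4 : ℝ) ^ ((n : ℝ) / 4)) := by
            gcongr
            exact Real.abs_cos_le_one _
        _ = (4 : ℝ) ^ (-(n : ℝ) * (1 / 4)) := by
            rw [one_mul, ← Real.rpow_add (by norm_num)]
            congr 1
            ring
        _ ≤ _ := le_rfl
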